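/- Let $n\ge 1$, let $\mathbb H=\{q_r+iq_i+jq_j+kq_k\}$ be the real quaternions, and for $\lambda=(\lambda_1,\dots,\lambda_{2n})\in\mathbb R^{2n}$ write $\tilde\lambda=(\lambda_2,\dots,\lambda_{2n})$. The two-sided quaternion Fourier transform of $f\in L^1(\mathbb R^{2n},\mathbb H)\cap L^2(\mathbb R^{2n},\mathbb H)$ is $$\mathcal F_Q(f)(u,v)=\int_{\mathbb R^{n}\times\mathbb R^n}e^{-2\pi i\,u\cdot x}f(x,y)\,e^{-2\pi j\,v\cdot y}\,dx\,dy,\qquad u,v\in\mathbb R^n,$$ and $\mathcal F_Q$ denotes also its extension by continuity to $L^2(\mathbb R^{2n},\mathbb H)$. A function $\psi\in L^2(\mathbb R^{2n},\mathbb H)$ is an admissible quaternion shearlet if $$C_\psi=\int_{\mathbb R^{2n}}\frac{|\mathcal F_Q(\psi^*)(\lambda_1,\tilde\lambda)|^2}{|\lambda_1|^{2n}}\,d\lambda<\infty,\qquad \psi^*(x)=\overline{\psi(-x)}.$$ For $a\in\mathbb R^*=\mathbb R\setminus\{0\}$ and $s\in\mathbb R^{2n-1}$ let $$A_a=\begin{pmatrix}a&0\\0&\operatorname{sg}(a)|a|^{\frac1{2n}}I_{2n-1}\end{pmatrix},\qquad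 S_s=\begin{pmatrix}1&s^T\\0&I_{2n-1}\end{pmatrix},$$ and for $t\in\mathbb R^{2n}$ let $\psi_{a,s,t}(x)=|a|^{\frac1{4n}-1}\psi(A_a^{-1}S_s^{-1}(x-t))$. The continuous quaternion shearlet transform of $f\in L^2(\mathbb R^{2n},\mathbb H)$ is $$\mathcal{SH}^Q_\psi(f)(a,s,t)=\int_{\mathbb R^{2n}}f(x)\,\overline{\psi_{a,s,t}(x)}\,dx,\qquad (a,s,t)\in\mathbb R^*\times\mathbb R^{2n-1}\times\mathbb R^{2n}.$$ Let $\mu$ be the measure $d\mu(a,s,t)=|a|^{-(2n+1)}\,da\,ds\,dt$ on $\mathbb R^*\times\mathbb R^{2n-1}\times\mathbb R^{2n}$, and write $\|F\|_{2,\mu}=\big(\int|F|^2d\mu\big)^{1/2}$. A function $F$ on this space is $\xi$-concentrated on a measurable set $\Sigma$ if $\big(\int_{\Sigma^c}|F|^2\,d\mu\big)^{1/2}\le\xi\,\|F\|_{2,\mu}$. **Theorem (Donoho–Stark uncertainty principle for $\mathcal{SH}^Q_\psi$).** Let $\psi$ be a nonzero admissible quaternion shearlet, let $f\in L^2(\mathbb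 R^{2n},\mathbb H)$ with $f\ne0$, let $\Sigma\subseteq\mathbb R^*\times\mathbb R^{2n-1}\times\mathbb R^{2n}$ be a measurable set, and let $\xi\ge0$. If $\mathcal{SH}^Q_\psi(f)$ is $\xi$-concentrated on $\Sigma$, then $$\mu(\Sigma)\ \ge\ (1-\xi^2)\,\frac{C_\psi}{\|\psi\|_2^2}.$$ -/

import Mathlib

open MeasureTheory Filter Topology
open scoped Quaternion ENNReal Matrix

namespace QShearlet

noncomputable section

/-- `e^{iθ} = cos θ + i sin θ`, a quaternion. -/
def expI (θ : ℝ) : ℍ[ℝ] := ⟨Real.cos θ, Real.sin θ, 0, 0⟩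

/-- `e^{jθ} = cos θ + j sin θ`, a quaternion. -/
def expJ (θ : ℝ) : ℍ[ℝ] := ⟨Real.cos θ, 0, Real.sin θ, 0⟩

/-- The scalar product `u · x` of the first halves of two vectors of `ℝ^{2n}`. -/
def dotFst {n : ℕ} (w z : Fin (2 * n) → ℝ) : ℝ :=
  ∑ p : Fin n, w ⟨p.val, by omega⟩ * z ⟨p.val, by omega⟩

/-- The scalar product `v · y` of the second halves of two vectors of `ℝ^{2n}`. -/
def dotSnd {n : ℕ} (w z : Fin (2 * n) → ℝ) : ℝ :=
  ∑ q : Fin n, w ⟨n + q.val, by omega⟩ * z ⟨n + q.val, by omega⟩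

/-- The two-sided quaternion Fourier transform of an integrable function, where `w = (u, v)` and
`z = (x, y)`: `∫ e^{-2πi u·x} f(x,y) e^{-2πj v·y} dx dy`. -/
def qft {n : ℕ} (f : (Fin (2 * n) → ℝ) → ℍ[ℝ]) (w : Fin (2 * n) → ℝ) : ℍ[ℝ] :=
  ∫ z, expI (-2 * Real.pi * dotFst w z) * f z * expJ (-2 * Real.pi * dotSnd w z)

/-- `G` represents the `L²` quaternion Fourier transform of `g`, the extension by continuity of
`qft` from `L¹ ∩ L²` to `L²`: there are `h k ∈ L¹ ∩ L²` with `h k → g` and `qft (h k) → G`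
in `L²`. -/
def IsQFT {n : ℕ} (g G : (Fin (2 * n) → ℝ) → ℍ[ℝ]) : Prop :=
  MemLp G 2 volume ∧
  ∃ h : ℕ → (Fin (2 * n) → ℝ) → ℍ[ℝ],
    (∀ k, MemLp (h k) 1 volume ∧ MemLp (h k) 2 volume) ∧
    Tendsto (fun k => eLpNorm (h k - g) 2 volume) atTop (𝓝 0) ∧
    Tendsto (fun k => eLpNorm (qft (h k) - G) 2 volume) atTop (𝓝 0)

/-- The quaternion Fourier transform of `g ∈ L²(ℝ^{2n}, ℍ)`. It is determined up to a null set;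
the value is a representative. -/
def qftL2 {n : ℕ} (g : (Fin (2 * n) → ℝ) → ℍ[ℝ]) : (Fin (2 * n) → ℝ) → ℍ[ℝ] :=
  Classical.epsilon (IsQFT g)

/-- `A_a = diag(a, sg(a)|a|^{1/(2n)}, …, sg(a)|a|^{1/(2n)})`. -/
def dilationMatrix (n : ℕ) (a : ℝ) : Matrix (Fin (2 * n)) (Fin (2 * n)) ℝ :=
  Matrix.diagonal fun i =>
    if i.val = 0 then a else Real.sign a * |a| ^ ((1 : ℝ) / (2 * (n : ℝ)))

/-- `S_s`: ones on the diagonal, first row `(1, s_1, …, s_{2n-1})`, zeros elsewhere. -/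
def shearMatrix (n : ℕ) (s : Fin (2 * n - 1) → ℝ) : Matrix (Fin (2 * n)) (Fin (2 * n)) ℝ :=
  Matrix.of fun i j =>
    if i = j then 1
    else if h : i.val = 0 ∧ j.val ≠ 0 then s ⟨j.val - 1, by omega⟩
    else 0

/-- The parameter space `ℝ* × ℝ^{2n-1} × ℝ^{2n}`. -/
abbrev Params (n : ℕ) : Type :=
  {a : ℝ // a ≠ 0} × (Fin (2 * n - 1) → ℝ) × (Fin (2 * n) → ℝ)

/-- The left Haar measure `dμ(a,s,t) = |a|^{-(2n+1)} da ds dt` of the shearlet group. -/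
def shearletMeasure (n : ℕ) : Measure (Params n) :=
  (((volume : Measure ℝ).comap Subtype.val).prod
    ((volume : Measure (Fin (2 * n - 1) → ℝ)).prod
      (volume : Measure (Fin (2 * n) → ℝ)))).withDensity
    fun p => ENNReal.ofReal (1 / |(p.1 : ℝ)| ^ (2 * n + 1))

/-- `ψ_{a,s,t}(x) = |a|^{1/(4n) - 1} ψ(A_a⁻¹ S_s⁻¹ (x - t))`. -/
def shearletAtom {n : ℕ} (ψ : (Fin (2 * n) → ℝ) → ℍ[ℝ]) (p : Params n)
    (x : Fin (2 * n) → ℝ) : ℍ[ℝ] :=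
  (|(p.1 : ℝ)| ^ ((1 : ℝ) / (4 * (n : ℝ)) - 1)) •
    ψ (((dilationMatrix n (p.1 : ℝ))⁻¹ * (shearMatrix n p.2.1)⁻¹) *ᵥ (x - p.2.2))

/-- The continuous quaternion shearlet transform
`SH_ψ(f)(a,s,t) = ∫ f(x) conj(ψ_{a,s,t}(x)) dx`. -/
def shearletTransform {n : ℕ} (ψ f : (Fin (2 * n) → ℝ) → ℍ[ℝ]) (p : Params n) : ℍ[ℝ] :=
  ∫ x, f x * star (shearletAtom ψ p x)

/-- `C_ψ = ∫ |F_Q(ψ*)(λ)|² / |λ_1|^{2n} dλ`, where `ψ*(x) = conj(ψ(-x))`. -/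
def admissibilityConst {n : ℕ} [NeZero n] (ψ : (Fin (2 * n) → ℝ) → ℍ[ℝ]) : ℝ≥0∞ :=
  ∫⁻ l : Fin (2 * n) → ℝ, ‖qftL2 (fun x => star (ψ (-x))) l‖ₑ ^ 2 / ‖l 0‖ₑ ^ (2 * n)

/-- An admissible quaternion shearlet: `ψ ∈ L²(ℝ^{2n}, ℍ)` with `C_ψ < ∞`. -/
def IsAdmissible {n : ℕ} [NeZero n] (ψ : (Fin (2 * n) → ℝ) → ℍ[ℝ]) : Prop :=
  MemLp ψ 2 volume ∧ admissibilityConst ψ < ∞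

/-- `F` is `ξ`-concentrated on `E`: `(∫_{Eᶜ} |F|² dμ)^{1/2} ≤ ξ ‖F‖_{2,μ}`. -/
def IsConcentrated {n : ℕ} (ξ : ℝ) (E : Set (Params n)) (F : Params n → ℍ[ℝ]) : Prop :=
  eLpNorm F 2 ((shearletMeasure n).restrict Eᶜ) ≤
    ENNReal.ofReal ξ * eLpNorm F 2 (shearletMeasure n)

end

end QShearlet

/-!
The shearlet transform spreads out because it is, up to the factor `√C_ψ`, an isometry, while its
values are bounded. Plancherel's formula `‖SH_ψ f‖²_{2,μ} = C_ψ ‖f‖²`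
(`QShearlet.lintegral_enorm_sq_shearletTransform`) and the Cauchy–Schwarz bound
`|SH_ψ f| ≤ ‖f‖ ‖ψ‖` (`QShearlet.enorm_shearletTransform_le`) give

  `C_ψ ‖f‖² = ∫_E |SH_ψ f|² dμ + ∫_{Eᶜ} |SH_ψ f|² dμ ≤ μ(E) ‖f‖² ‖ψ‖² + ξ² C_ψ ‖f‖²`,

and division by `‖f‖² ‖ψ‖²` is the claim.

The work is in Plancherel's formula. The two-sided quaternion Fourier transform does not turn
correlations into products, so it is replaced by the cosine and sine transforms `P`, `S` of a
function, the two parts of its ordinary Fourier transform `P - iS` with values in the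
complexification `ℍ ⊗ ℂ`. These are compatible with left multiplication by quaternions, with
translations and with linear substitutions, and the sum of the squared norms of `P` and `S` is that
of the function. The correlation `t ↦ ∫ f(x) conj(g(x - t)) dx` has the transform
`(P_f - iS_f) (P_g - iS_g)^*` (`QShearlet.IsCosSinT.correlation_eq`). The norm on `ℍ ⊗ ℂ` is not
multiplicative, but it becomes so after averaging over the two signs of `S_g`
(`QShearlet.enorm_cross_add_cross_neg`), by the parallelogram law. Since `A_{-a} = -A_a`, replacing
`a` by `-a` changes exactly that sign for `g = ψ_{a,s,0}`, and the integral over `a ∈ ℝ*` does the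
averaging. What remains is a substitution along the orbits `(a, s) ↦ A_a S_s^T w`, which cover
almost all frequencies (`QShearlet.lintegral_orbit`).

The constant `C_ψ` is defined by the quaternion Fourier transform of `ψ*`. That transform at
`(u, v)` is a combination of the values of `P` and `S` at `(u, v)` and `(u, -v)`, and summing over
the signs of `u` and `v` cancels the cross terms (`QShearlet.sum_flip_enorm_sq_qftComb`). The weight
`|λ_1|^{-2n}` does not depend on these signs, hence `C_ψ = ∫ (|P|² + |S|²) |λ_1|^{-2n} dλ`
(`QShearlet.admissibilityConst_eq`).
-/

namespace QShearlet

/-! ### Plancherel for cosine and sine transforms -/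

section

/-- The Fourier integral of a function in `L¹ ∩ L²` represents its `L²` Fourier transform: both
define the same tempered distribution. -/
theorem fourier_toLp_ae_eq {V F : Type*} [NormedAddCommGroup V] [InnerProductSpace ℝ V]
    [FiniteDimensional ℝ V] [MeasurableSpace V] [BorelSpace V]
    [NormedAddCommGroup F] [InnerProductSpace ℂ F] [CompleteSpace F]
    {h : V → F} (h1 : MemLp h 1 volume) (h2 : MemLp h 2 volume) :
    (FourierTransform.fourier (h2.toLp h) : Lp F 2 (volume : Measure V)) =ᵐ[volume]
      FourierTransform.fourier h := by
  have hint : Integrable h := memLp_one_iff_integrable.1 h1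
  have hcont : Continuous (FourierTransform.fourier h : V → F) :=
    VectorFourier.fourierIntegral_continuous Real.continuous_fourierChar
      (innerSL ℝ).continuous₂ hint
  refine ae_eq_of_integral_contDiff_smul_eq
    ((Lp.memLp _).locallyIntegrable one_le_two) hcont.locallyIntegrable ?_
  intro g g_smooth g_cpt
  have hg₁ : HasCompactSupport (Complex.ofRealCLM ∘ g) := g_cpt.comp_left rfl
  have hg₂ : ContDiff ℝ ((⊤ : ℕ∞) : WithTop ℕ∞) (Complex.ofRealCLM ∘ g) := by fun_prop
  set φ : SchwartzMap V ℂ := hg₁.toSchwartzMap hg₂ with hφ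
  have hφg : ∀ x, φ x = (g x : ℂ) := fun x => by simp [hφ]
  have e1 := congrArg (fun T => T φ) (Lp.fourier_toTemperedDistribution_eq (h2.toLp h))
  simp only [TemperedDistribution.fourier_apply, Lp.toTemperedDistribution_apply] at e1
  have e2 := VectorFourier.integral_fourierIntegral_smul_eq_flip (μ := (volume : Measure V))
    (ν := (volume : Measure V)) (L := innerₗ V)
    Real.continuous_fourierChar (innerSL ℝ).continuous₂ (φ.integrable (μ := volume)) hint
  have e3 : ∫ x, (FourierTransform.fourier φ : SchwartzMap V ℂ) x • (h2.toLp h) x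
      = ∫ x, φ x • FourierTransform.fourier h x := by
    calc _ = ∫ x, (FourierTransform.fourier φ : SchwartzMap V ℂ) x • h x := by
          refine integral_congr_ae ?_
          filter_upwards [h2.coeFn_toLp] with x hx
          rw [hx]
      _ = _ := by
          rw [flip_innerₗ] at e2
          exact e2
  calc ∫ x, g x • (FourierTransform.fourier (h2.toLp h) : Lp F 2 (volume : Measure V)) x
      = ∫ x, φ x • (FourierTransform.fourier (h2.toLp h) : Lp F 2 (volume : Measure V)) x := by
        simp [hφg]
    _ = ∫ x, φ x • FourierTransform.fourier h x := by rw [← e1, e3]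
    _ = _ := by simp [hφg]

theorem eLpNorm_fourier_eq {V F : Type*} [NormedAddCommGroup V] [InnerProductSpace ℝ V]
    [FiniteDimensional ℝ V] [MeasurableSpace V] [BorelSpace V]
    [NormedAddCommGroup F] [InnerProductSpace ℂ F] [CompleteSpace F]
    {h : V → F} (h1 : MemLp h 1 volume) (h2 : MemLp h 2 volume) :
    eLpNorm (FourierTransform.fourier h : V → F) 2 volume = eLpNorm h 2 volume := by
  rw [← eLpNorm_congr_ae (fourier_toLp_ae_eq h1 h2), ← eLpNorm_congr_ae h2.coeFn_toLp,
    ← Lp.enorm_def, ← Lp.enorm_def, ← ofReal_norm, ← ofReal_norm, Lp.norm_fourier_eq]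

theorem eLpNorm_two_sq {α G : Type*} [MeasurableSpace α] [NormedAddCommGroup G] (f : α → G)
    (μ : Measure α) : eLpNorm f 2 μ ^ 2 = ∫⁻ x, ‖f x‖ₑ ^ 2 ∂μ := by
  simpa using eLpNorm_nnreal_pow_eq_lintegral (f := f) (μ := μ) (p := 2) two_ne_zero

theorem enorm_sq_eq_ofReal {G : Type*} [NormedAddCommGroup G] (x : G) :
    ‖x‖ₑ ^ 2 = ENNReal.ofReal (‖x‖ ^ 2) := by
  rw [ENNReal.ofReal_pow (norm_nonneg _), ofReal_norm]

theorem norm_sq_quaternion (q : ℍ[ℝ]) :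
    ‖q‖ ^ 2 = q.re ^ 2 + q.imI ^ 2 + q.imJ ^ 2 + q.imK ^ 2 := by
  rw [sq, ← Quaternion.normSq_eq_norm_mul_self, Quaternion.normSq_def']

variable {ι : Type*} [Fintype ι]

/-- The cosine transform `w ↦ ∫ cos(2π w·z) h(z) dz` of a quaternion-valued function. -/
noncomputable def cosT (h : (ι → ℝ) → ℍ[ℝ]) (w : ι → ℝ) : ℍ[ℝ] :=
  ∫ z, Real.cos (2 * Real.pi * (w ⬝ᵥ z)) • h z

/-- The sine transform `w ↦ ∫ sin(2π w·z) h(z) dz` of a quaternion-valued function. -/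
noncomputable def sinT (h : (ι → ℝ) → ℍ[ℝ]) (w : ι → ℝ) : ℍ[ℝ] :=
  ∫ z, Real.sin (2 * Real.pi * (w ⬝ᵥ z)) • h z

/-- The embedding of the quaternions into their complexification `ℍ ⊗ ℂ = ℂ⁴`. -/
noncomputable def toComplexification : ℍ[ℝ] →L[ℝ] EuclideanSpace ℂ (Fin 4) :=
  LinearMap.toContinuousLinearMap
    { toFun := fun q => WithLp.toLp 2 ![(q.re : ℂ), (q.imI : ℂ), (q.imJ : ℂ), (q.imK : ℂ)]
      map_add' := fun a b => by ext i; fin_cases i <;> simp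
      map_smul' := fun c a => by ext i; fin_cases i <;> simp }

theorem norm_sq_toComplexification_sub (a b : ℍ[ℝ]) :
    ‖toComplexification a - Complex.I • toComplexification b‖ ^ 2 = ‖a‖ ^ 2 + ‖b‖ ^ 2 := by
  rw [EuclideanSpace.norm_sq_eq, Fin.sum_univ_four]
  simp only [toComplexification, LinearMap.coe_toContinuousLinearMap', LinearMap.coe_mk,
    AddHom.coe_mk, PiLp.sub_apply, PiLp.smul_apply, Complex.sq_norm, Complex.normSq_apply,
    norm_sq_quaternion]
  simp
  ring

theorem norm_toComplexification (a : ℍ[ℝ]) : ‖toComplexification a‖ = ‖a‖ := by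
  have := norm_sq_toComplexification_sub a 0
  simp only [map_zero, smul_zero, sub_zero, norm_zero, ne_eq, OfNat.ofNat_ne_zero,
    not_false_eq_true, zero_pow, add_zero] at this
  exact (pow_left_inj₀ (norm_nonneg _) (norm_nonneg _) two_ne_zero).1 this

theorem continuous_dotProduct_left (w : ι → ℝ) : Continuous fun z : ι → ℝ => w ⬝ᵥ z := by
  unfold dotProduct; fun_prop

theorem continuous_dotProduct_right (z : ι → ℝ) : Continuous fun w : ι → ℝ => w ⬝ᵥ z := by
  unfold dotProduct; fun_prop

theorem integrable_cos_smul {h : (ι → ℝ) → ℍ[ℝ]} (hh : Integrable h) (w : ι → ℝ) :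
    Integrable fun z => Real.cos (2 * Real.pi * (w ⬝ᵥ z)) • h z := by
  refine hh.bdd_smul (φ := fun z => Real.cos (2 * Real.pi * (w ⬝ᵥ z))) 1 ?_
    (ae_of_all _ fun z => Real.abs_cos_le_one _)
  have := continuous_dotProduct_left w
  exact Continuous.aestronglyMeasurable (by fun_prop)

theorem integrable_sin_smul {h : (ι → ℝ) → ℍ[ℝ]} (hh : Integrable h) (w : ι → ℝ) :
    Integrable fun z => Real.sin (2 * Real.pi * (w ⬝ᵥ z)) • h z := by
  refine hh.bdd_smul (φ := fun z => Real.sin (2 * Real.pi * (w ⬝ᵥ z))) 1 ?_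
    (ae_of_all _ fun z => Real.abs_sin_le_one _)
  have := continuous_dotProduct_left w
  exact Continuous.aestronglyMeasurable (by fun_prop)

theorem continuous_cosT {h : (ι → ℝ) → ℍ[ℝ]} (hh : Integrable h) : Continuous (cosT h) := by
  refine continuous_of_dominated (bound := fun z => ‖h z‖)
    (fun w => (integrable_cos_smul hh w).aestronglyMeasurable) (fun w => ae_of_all _ fun z => ?_)
    hh.norm (ae_of_all _ fun z => ?_)
  · rw [norm_smul]
    exact mul_le_of_le_one_left (norm_nonneg _) (Real.abs_cos_le_one _)
  · have := continuous_dotProduct_right z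
    fun_prop

theorem continuous_sinT {h : (ι → ℝ) → ℍ[ℝ]} (hh : Integrable h) : Continuous (sinT h) := by
  refine continuous_of_dominated (bound := fun z => ‖h z‖)
    (fun w => (integrable_sin_smul hh w).aestronglyMeasurable) (fun w => ae_of_all _ fun z => ?_)
    hh.norm (ae_of_all _ fun z => ?_)
  · rw [norm_smul]
    exact mul_le_of_le_one_left (norm_nonneg _) (Real.abs_sin_le_one _)
  · have := continuous_dotProduct_right z
    fun_prop

theorem cosT_sub {g h : (ι → ℝ) → ℍ[ℝ]} (hg : Integrable g) (hh : Integrable h) :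
    cosT (g - h) = cosT g - cosT h := by
  ext1 w
  simp only [cosT, Pi.sub_apply, smul_sub]
  exact integral_sub (integrable_cos_smul hg w) (integrable_cos_smul hh w)

theorem sinT_sub {g h : (ι → ℝ) → ℍ[ℝ]} (hg : Integrable g) (hh : Integrable h) :
    sinT (g - h) = sinT g - sinT h := by
  ext1 w
  simp only [sinT, Pi.sub_apply, smul_sub]
  exact integral_sub (integrable_sin_smul hg w) (integrable_sin_smul hh w)

theorem cosT_add {g h : (ι → ℝ) → ℍ[ℝ]} (hg : Integrable g) (hh : Integrable h) :
    cosT (g + h) = cosT g + cosT h := by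
  ext1 w
  simp only [cosT, Pi.add_apply, smul_add]
  exact integral_add (integrable_cos_smul hg w) (integrable_cos_smul hh w)

theorem sinT_add {g h : (ι → ℝ) → ℍ[ℝ]} (hg : Integrable g) (hh : Integrable h) :
    sinT (g + h) = sinT g + sinT h := by
  ext1 w
  simp only [sinT, Pi.add_apply, smul_add]
  exact integral_add (integrable_sin_smul hg w) (integrable_sin_smul hh w)

theorem cosT_neg (h : (ι → ℝ) → ℍ[ℝ]) (w : ι → ℝ) : cosT h (-w) = cosT h w := by
  simp [cosT]

theorem sinT_neg (h : (ι → ℝ) → ℍ[ℝ]) (w : ι → ℝ) : sinT h (-w) = -sinT h w := by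
  simp [sinT, integral_neg]

/-- The complex Fourier transform of `h`, with values in `ℍ ⊗ ℂ`, is `cosT h - i sinT h`. -/
theorem fourier_toComplexification {h : (ι → ℝ) → ℍ[ℝ]} (hh : Integrable h)
    (w : EuclideanSpace ℝ ι) :
    FourierTransform.fourier
        (fun z : EuclideanSpace ℝ ι => toComplexification (h (WithLp.ofLp z))) w =
      toComplexification (cosT h (WithLp.ofLp w)) -
        Complex.I • toComplexification (sinT h (WithLp.ofLp w)) := by
  have hc := toComplexification.integrable_comp (integrable_cos_smul hh (WithLp.ofLp w))
  have hs := toComplexification.integrable_comp (integrable_sin_smul hh (WithLp.ofLp w))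
  rw [cosT, sinT, ← ContinuousLinearMap.integral_comp_comm _ (integrable_cos_smul hh _),
    ← ContinuousLinearMap.integral_comp_comm _ (integrable_sin_smul hh _), ← integral_smul,
    ← integral_sub hc (hs.fun_smul Complex.I), Real.fourier_eq']
  rw [← (PiLp.volume_preserving_ofLp ι).integral_comp
    (MeasurableEquiv.toLp 2 (ι → ℝ)).symm.measurableEmbedding]
  refine integral_congr_ae (ae_of_all _ fun z => ?_)
  have e : inner ℝ z w = WithLp.ofLp w ⬝ᵥ WithLp.ofLp z := by
    simp [EuclideanSpace.inner_eq_star_dotProduct]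
  have e2 : Complex.exp (((-2 * Real.pi * inner ℝ z w : ℝ) : ℂ) * Complex.I) =
      ((Real.cos (2 * Real.pi * (WithLp.ofLp w ⬝ᵥ WithLp.ofLp z)) : ℝ) : ℂ) -
        Complex.I * ((Real.sin (2 * Real.pi * (WithLp.ofLp w ⬝ᵥ WithLp.ofLp z)) : ℝ) : ℂ) := by
    rw [Complex.exp_mul_I, e, ← Complex.ofReal_cos, ← Complex.ofReal_sin, neg_mul, neg_mul,
      Real.cos_neg, Real.sin_neg]
    push_cast
    ring
  simp only [e2, map_smul, sub_smul, mul_smul, Complex.coe_smul]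

/-- Plancherel's theorem for the pair of the cosine and the sine transform. -/
theorem plancherel_cosT_sinT {h : (ι → ℝ) → ℍ[ℝ]} (h1 : MemLp h 1 volume)
    (h2 : MemLp h 2 volume) :
    eLpNorm (cosT h) 2 volume ^ 2 + eLpNorm (sinT h) 2 volume ^ 2 = eLpNorm h 2 volume ^ 2 := by
  have hint : Integrable h := memLp_one_iff_integrable.1 h1
  have mp := PiLp.volume_preserving_ofLp ι
  have key := eLpNorm_fourier_eq
    (toComplexification.comp_memLp' (h1.comp_measurePreserving mp))
    (toComplexification.comp_memLp' (h2.comp_measurePreserving mp))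
  have key2 : ∫⁻ w : EuclideanSpace ℝ ι, (‖cosT h (WithLp.ofLp w)‖ₑ ^ 2
      + ‖sinT h (WithLp.ofLp w)‖ₑ ^ 2) = ∫⁻ w : EuclideanSpace ℝ ι, ‖h (WithLp.ofLp w)‖ₑ ^ 2 := by
    have k := congrArg (· ^ 2) key
    simp only [eLpNorm_two_sq] at k
    convert k using 1
    · refine lintegral_congr fun w => ?_
      have := fourier_toComplexification hint w
      simp only [Function.comp_def]
      rw [this, enorm_sq_eq_ofReal (_ - _), norm_sq_toComplexification_sub,
        ENNReal.ofReal_add (by positivity) (by positivity), enorm_sq_eq_ofReal,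
        enorm_sq_eq_ofReal]
    · refine lintegral_congr fun w => ?_
      simp only [Function.comp_def, enorm_sq_eq_ofReal, norm_toComplexification]
  rw [eLpNorm_two_sq, eLpNorm_two_sq, eLpNorm_two_sq,
    ← lintegral_add_left ((continuous_cosT hint).enorm.measurable.pow_const 2)]
  have em := (MeasurableEquiv.toLp 2 (ι → ℝ)).symm.measurableEmbedding
  rw [← mp.lintegral_comp_emb em, ← mp.lintegral_comp_emb em]
  exact key2

theorem eLpNorm_cosT_le {h : (ι → ℝ) → ℍ[ℝ]} (h1 : MemLp h 1 volume) (h2 : MemLp h 2 volume) :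
    eLpNorm (cosT h) 2 volume ≤ eLpNorm h 2 volume := by
  rw [← ENNReal.pow_le_pow_left_iff two_ne_zero, ← plancherel_cosT_sinT h1 h2]
  exact le_self_add

theorem eLpNorm_sinT_le {h : (ι → ℝ) → ℍ[ℝ]} (h1 : MemLp h 1 volume) (h2 : MemLp h 2 volume) :
    eLpNorm (sinT h) 2 volume ≤ eLpNorm h 2 volume := by
  rw [← ENNReal.pow_le_pow_left_iff two_ne_zero, ← plancherel_cosT_sinT h1 h2]
  exact le_add_self

theorem memLp_cosT {h : (ι → ℝ) → ℍ[ℝ]} (h1 : MemLp h 1 volume) (h2 : MemLp h 2 volume) :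
    MemLp (cosT h) 2 volume :=
  ⟨(continuous_cosT (memLp_one_iff_integrable.1 h1)).aestronglyMeasurable,
    (eLpNorm_cosT_le h1 h2).trans_lt h2.2⟩

theorem memLp_sinT {h : (ι → ℝ) → ℍ[ℝ]} (h1 : MemLp h 1 volume) (h2 : MemLp h 2 volume) :
    MemLp (sinT h) 2 volume :=
  ⟨(continuous_sinT (memLp_one_iff_integrable.1 h1)).aestronglyMeasurable,
    (eLpNorm_sinT_le h1 h2).trans_lt h2.2⟩

end

/-! ### The cosine and sine transforms of square-integrable functions -/

section

variable {ι : Type*} [Fintype ι]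

/-- `P` and `S` represent the `L²` cosine and sine transforms of `f ∈ L²`: they are the `L²` limits
of `cosT (h k)` and `sinT (h k)` for some `h k ∈ L¹ ∩ L²` with `h k → f` in `L²`. -/
structure IsCosSinT (f P S : (ι → ℝ) → ℍ[ℝ]) : Prop where
  memLp : MemLp f 2 volume
  memLp_cos : MemLp P 2 volume
  memLp_sin : MemLp S 2 volume
  exists_approx : ∃ h : ℕ → (ι → ℝ) → ℍ[ℝ],
    (∀ k, MemLp (h k) 1 volume ∧ MemLp (h k) 2 volume) ∧
    Tendsto (fun k => eLpNorm (h k - f) 2 volume) atTop (𝓝 0) ∧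
    Tendsto (fun k => eLpNorm (cosT (h k) - P) 2 volume) atTop (𝓝 0) ∧
    Tendsto (fun k => eLpNorm (sinT (h k) - S) 2 volume) atTop (𝓝 0)

theorem norm_toLp_sq {h : (ι → ℝ) → ℍ[ℝ]} (h1 : MemLp h 1 volume) (h2 : MemLp h 2 volume) :
    ‖h2.toLp h‖ ^ 2 =
      ‖(memLp_cosT h1 h2).toLp (cosT h)‖ ^ 2 + ‖(memLp_sinT h1 h2).toLp (sinT h)‖ ^ 2 := by
  simp only [Lp.norm_toLp]
  rw [← ENNReal.toReal_pow, ← ENNReal.toReal_pow, ← ENNReal.toReal_pow,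
    ← plancherel_cosT_sinT h1 h2, ENNReal.toReal_add]
  · exact ENNReal.pow_ne_top (memLp_cosT h1 h2).2.ne
  · exact ENNReal.pow_ne_top (memLp_sinT h1 h2).2.ne

/-- Parseval's identity on `L¹ ∩ L²`, by polarization of Plancherel's theorem. -/
theorem inner_toLp_eq {g h : (ι → ℝ) → ℍ[ℝ]} (g1 : MemLp g 1 volume) (g2 : MemLp g 2 volume)
    (h1 : MemLp h 1 volume) (h2 : MemLp h 2 volume) :
    inner ℝ (g2.toLp g) (h2.toLp h) =
      inner ℝ ((memLp_cosT g1 g2).toLp (cosT g)) ((memLp_cosT h1 h2).toLp (cosT h)) +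
      inner ℝ ((memLp_sinT g1 g2).toLp (sinT g)) ((memLp_sinT h1 h2).toLp (sinT h)) := by
  have hadd := norm_toLp_sq (g1.add h1) (g2.add h2)
  have ec : (memLp_cosT (g1.add h1) (g2.add h2)).toLp (cosT (g + h)) =
      (memLp_cosT g1 g2).toLp (cosT g) + (memLp_cosT h1 h2).toLp (cosT h) := by
    rw [← MemLp.toLp_add]
    exact MemLp.toLp_congr _ _ (Eventually.of_forall fun x => congrFun
      (cosT_add (memLp_one_iff_integrable.1 g1) (memLp_one_iff_integrable.1 h1)) x)
  have es : (memLp_sinT (g1.add h1) (g2.add h2)).toLp (sinT (g + h)) =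
      (memLp_sinT g1 g2).toLp (sinT g) + (memLp_sinT h1 h2).toLp (sinT h) := by
    rw [← MemLp.toLp_add]
    exact MemLp.toLp_congr _ _ (Eventually.of_forall fun x => congrFun
      (sinT_add (memLp_one_iff_integrable.1 g1) (memLp_one_iff_integrable.1 h1)) x)
  rw [ec, es, MemLp.toLp_add g2 h2] at hadd
  rw [norm_add_sq_real, norm_add_sq_real, norm_add_sq_real] at hadd
  linarith [norm_toLp_sq g1 g2, norm_toLp_sq h1 h2]

theorem tendsto_toLp {α : Type*} [MeasurableSpace α] {μ : Measure α} {u : ℕ → α → ℍ[ℝ]}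
    {v : α → ℍ[ℝ]} (hu : ∀ k, MemLp (u k) 2 μ) (hv : MemLp v 2 μ)
    (h : Tendsto (fun k => eLpNorm (u k - v) 2 μ) atTop (𝓝 0)) :
    Tendsto (fun k => (hu k).toLp (u k)) atTop (𝓝 (hv.toLp v)) :=
  (Lp.tendsto_Lp_iff_tendsto_eLpNorm'' _ hu _ hv).2 h

/-- Parseval's identity for the cosine and sine transforms. -/
theorem IsCosSinT.integral_inner {f P S g Q T : (ι → ℝ) → ℍ[ℝ]} (hf : IsCosSinT f P S)
    (hg : IsCosSinT g Q T) :
    ∫ x, inner ℝ (f x) (g x) = (∫ x, inner ℝ (P x) (Q x)) + ∫ x, inner ℝ (S x) (T x) := by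
  obtain ⟨u, hu, u0, uc, us⟩ := hf.exists_approx
  obtain ⟨v, hv, v0, vc, vs⟩ := hg.exists_approx
  have key := tendsto_nhds_unique
    ((tendsto_toLp (fun k => (hu k).2) hf.memLp u0).inner (𝕜 := ℝ)
      (tendsto_toLp (fun k => (hv k).2) hg.memLp v0))
    ((((tendsto_toLp (fun k => memLp_cosT (hu k).1 (hu k).2) hf.memLp_cos uc).inner (𝕜 := ℝ)
      (tendsto_toLp (fun k => memLp_cosT (hv k).1 (hv k).2) hg.memLp_cos vc)).add
      ((tendsto_toLp (fun k => memLp_sinT (hu k).1 (hu k).2) hf.memLp_sin us).inner (𝕜 := ℝ)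
      (tendsto_toLp (fun k => memLp_sinT (hv k).1 (hv k).2) hg.memLp_sin vs))).congr
      fun k => (inner_toLp_eq (hu k).1 (hu k).2 (hv k).1 (hv k).2).symm)
  have conv : ∀ {a b : (ι → ℝ) → ℍ[ℝ]} (ha : MemLp a 2 volume) (hb : MemLp b 2 volume),
      inner ℝ (ha.toLp a) (hb.toLp b) = ∫ x, inner ℝ (a x) (b x) := by
    intro a b ha hb
    rw [L2.inner_def]
    refine integral_congr_ae ?_
    filter_upwards [ha.coeFn_toLp, hb.coeFn_toLp] with x hx hy
    rw [hx, hy]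
  rwa [conv, conv, conv] at key

theorem tendsto_eLpNorm_of_le {G : Type*} [NormedAddCommGroup G] {α : Type*} [MeasurableSpace α]
    {μ : Measure α} {a : ℕ → α → G} {x y : ℕ → ℝ≥0∞} (c : ℝ≥0∞) (hc : c ≠ ∞)
    (hx : Tendsto x atTop (𝓝 0)) (hy : Tendsto y atTop (𝓝 0))
    (h : ∀ k, eLpNorm (a k) 2 μ ≤ c * (x k + y k)) :
    Tendsto (fun k => eLpNorm (a k) 2 μ) atTop (𝓝 0) := by
  refine tendsto_of_tendsto_of_tendsto_of_le_of_le tendsto_const_nhds ?_ (fun _ => zero_le) h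
  simpa using ENNReal.Tendsto.const_mul (hx.add hy) (Or.inr hc)

theorem exists_strongly_limit_of_cauchy {u : ℕ → (ι → ℝ) → ℍ[ℝ]} (hu : ∀ k, MemLp (u k) 2 volume)
    (hc : CauchySeq fun k => (hu k).toLp (u k)) :
    ∃ P : (ι → ℝ) → ℍ[ℝ], StronglyMeasurable P ∧ MemLp P 2 volume ∧
      Tendsto (fun k => eLpNorm (u k - P) 2 volume) atTop (𝓝 0) := by
  obtain ⟨L, hL⟩ := cauchySeq_tendsto_of_complete hc
  refine ⟨L, Lp.stronglyMeasurable L, Lp.memLp L, ?_⟩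
  refine (Lp.tendsto_Lp_iff_tendsto_eLpNorm'' _ hu _ (Lp.memLp L)).1 ?_
  simpa using hL

theorem eLpNorm_comp_neg {G : Type*} [NormedAddCommGroup G] (u : (ι → ℝ) → G) :
    eLpNorm (fun x => u (-x)) 2 volume = eLpNorm u 2 volume := by
  refine (ENNReal.pow_right_strictMono two_ne_zero).injective ?_
  simp only [eLpNorm_two_sq]
  exact lintegral_neg_eq_self (fun x => ‖u x‖ₑ ^ 2)

/-- Averaging over `x ↦ -x` turns an `L²` limit of even functions into an even one, and
(with `ε = -1`) one of odd functions into an odd one. -/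
theorem exists_parity_limit {u : ℕ → (ι → ℝ) → ℍ[ℝ]} {P : (ι → ℝ) → ℍ[ℝ]} (ε : ℝ)
    (hε : ε * ε = 1) (hu : ∀ k x, u k (-x) = ε • u k x) (hum : ∀ k, MemLp (u k) 2 volume)
    (hPm : StronglyMeasurable P) (hP : MemLp P 2 volume)
    (h : Tendsto (fun k => eLpNorm (u k - P) 2 volume) atTop (𝓝 0)) :
    ∃ Q : (ι → ℝ) → ℍ[ℝ], StronglyMeasurable Q ∧ MemLp Q 2 volume ∧
      (∀ x, Q (-x) = ε • Q x) ∧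
      Tendsto (fun k => eLpNorm (u k - Q) 2 volume) atTop (𝓝 0) := by
  have hneg : MeasurePreserving (fun x : ι → ℝ => -x) volume volume :=
    Measure.measurePreserving_neg _
  have hPn : MemLp (fun x => P (-x)) 2 volume := hP.comp_measurePreserving hneg
  refine ⟨fun x => (1 / 2 : ℝ) • (P x + ε • P (-x)), ?_,
    (hP.add (hPn.const_smul ε)).const_smul (1 / 2 : ℝ), fun x => ?_, ?_⟩
  · exact (hPm.add ((hPm.comp_measurable measurable_neg).const_smul ε)).const_smul (1 / 2 : ℝ)
  · dsimp only
    rw [neg_neg, smul_comm ε, smul_add ε, smul_smul ε, hε, one_smul, add_comm]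
  · have hεn : ‖ε‖ₑ = 1 := by
      have h1 : |ε| = 1 := by
        rcases mul_self_eq_one_iff.1 hε with h | h <;> simp [h]
      rw [← ofReal_norm, Real.norm_eq_abs, h1, ENNReal.ofReal_one]
    refine tendsto_eLpNorm_of_le 1 ENNReal.one_ne_top h h fun k => ?_
    have e : (u k - fun x => (1 / 2 : ℝ) • (P x + ε • P (-x))) =
        (1 / 2 : ℝ) • ((u k - P) + ε • fun x => (u k - P) (-x)) := by
      ext1 x
      simp only [Pi.sub_apply, Pi.smul_apply, Pi.add_apply, hu, smul_sub, smul_add, smul_smul, hε]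
      module
    have hm : MemLp (u k - P) 2 volume := (hum k).sub hP
    rw [e, eLpNorm_const_smul]
    calc _ ≤ 1 * eLpNorm ((u k - P) + ε • fun x => (u k - P) (-x)) 2 volume := by
          gcongr
          rw [← ofReal_norm]
          norm_num
      _ ≤ 1 * (eLpNorm (u k - P) 2 volume + eLpNorm (ε • fun x => (u k - P) (-x)) 2 volume) := by
          gcongr
          exact eLpNorm_add_le hm.1
            ((hm.comp_measurePreserving hneg).const_smul ε).1 one_le_two
      _ = _ := by rw [eLpNorm_const_smul, eLpNorm_comp_neg (u k - P), hεn]; simp only [one_mul]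

/-- Every `f ∈ L²` has `L²` cosine and sine transforms, with representatives that are even and odd
everywhere, not just almost everywhere. -/
theorem exists_isCosSinT {f : (ι → ℝ) → ℍ[ℝ]} (hf : MemLp f 2 volume) :
    ∃ P S : (ι → ℝ) → ℍ[ℝ], StronglyMeasurable P ∧ StronglyMeasurable S ∧
      (∀ x, P (-x) = P x) ∧ (∀ x, S (-x) = -S x) ∧ IsCosSinT f P S := by
  have hex : ∀ k : ℕ, ∃ g : (ι → ℝ) → ℍ[ℝ], MemLp g 1 volume ∧ MemLp g 2 volume ∧
      eLpNorm (g - f) 2 volume ≤ ((k : ℝ≥0∞) + 1)⁻¹ := by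
    intro k
    obtain ⟨g, hgs, hgn, hgc, hg2⟩ := hf.exists_hasCompactSupport_eLpNorm_sub_le
      ENNReal.ofNat_ne_top (ε := ((k : ℝ≥0∞) + 1)⁻¹) (by simp)
    refine ⟨g, memLp_one_iff_integrable.2 (hgc.integrable_of_hasCompactSupport hgs), hg2, ?_⟩
    rwa [eLpNorm_sub_comm]
  choose h h1 h2 h3 using hex
  have h0 : Tendsto (fun k => eLpNorm (h k - f) 2 volume) atTop (𝓝 0) := by
    refine tendsto_of_tendsto_of_tendsto_of_le_of_le tendsto_const_nhds
      ((tendsto_add_atTop_iff_nat 1).2 ENNReal.tendsto_inv_nat_nhds_zero) (fun _ => zero_le) ?_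
    intro k
    simpa using h3 k
  have hcau : CauchySeq fun k => (h2 k).toLp (h k) := (tendsto_toLp h2 hf h0).cauchySeq
  have hint := fun k => memLp_one_iff_integrable.1 (h1 k)
  have hC : CauchySeq fun k => (memLp_cosT (h1 k) (h2 k)).toLp (cosT (h k)) := by
    rw [Metric.cauchySeq_iff] at hcau ⊢
    intro ε hε
    obtain ⟨N, hN⟩ := hcau ε hε
    refine ⟨N, fun m hm k hk => lt_of_le_of_lt ?_ (hN m hm k hk)⟩
    rw [Lp.dist_def, Lp.dist_def]
    rw [eLpNorm_congr_ae ((MemLp.coeFn_toLp _).sub (MemLp.coeFn_toLp _)),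
      eLpNorm_congr_ae ((MemLp.coeFn_toLp _).sub (MemLp.coeFn_toLp _)),
      ← cosT_sub (hint m) (hint k)]
    exact ENNReal.toReal_mono ((h2 m).sub (h2 k)).2.ne
      (eLpNorm_cosT_le ((h1 m).sub (h1 k)) ((h2 m).sub (h2 k)))
  have hS : CauchySeq fun k => (memLp_sinT (h1 k) (h2 k)).toLp (sinT (h k)) := by
    rw [Metric.cauchySeq_iff] at hcau ⊢
    intro ε hε
    obtain ⟨N, hN⟩ := hcau ε hε
    refine ⟨N, fun m hm k hk => lt_of_le_of_lt ?_ (hN m hm k hk)⟩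
    rw [Lp.dist_def, Lp.dist_def]
    rw [eLpNorm_congr_ae ((MemLp.coeFn_toLp _).sub (MemLp.coeFn_toLp _)),
      eLpNorm_congr_ae ((MemLp.coeFn_toLp _).sub (MemLp.coeFn_toLp _)),
      ← sinT_sub (hint m) (hint k)]
    exact ENNReal.toReal_mono ((h2 m).sub (h2 k)).2.ne
      (eLpNorm_sinT_le ((h1 m).sub (h1 k)) ((h2 m).sub (h2 k)))
  obtain ⟨P₀, hP₀m, hP₀, hP₀t⟩ := exists_strongly_limit_of_cauchy _ hC
  obtain ⟨S₀, hS₀m, hS₀, hS₀t⟩ := exists_strongly_limit_of_cauchy _ hS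
  obtain ⟨P, hPm, hP, hPe, hPt⟩ := exists_parity_limit 1 (by norm_num)
    (fun k x => by rw [one_smul, cosT_neg]) (fun k => memLp_cosT (h1 k) (h2 k)) hP₀m hP₀ hP₀t
  obtain ⟨S, hSm, hS, hSe, hSt⟩ := exists_parity_limit (-1) (by norm_num)
    (fun k x => by rw [neg_one_smul, sinT_neg]) (fun k => memLp_sinT (h1 k) (h2 k)) hS₀m hS₀ hS₀t
  exact ⟨P, S, hPm, hSm, by simpa using hPe, by simpa using hSe, hf, hP, hS, h,
    fun k => ⟨h1 k, h2 k⟩, h0, hPt, hSt⟩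

end

/-! ### Transformation rules -/

section

variable {ι : Type*} [Fintype ι]

instance instStarModuleQuaternion : StarModule ℝ ℍ[ℝ] :=
  ⟨fun s a => by rw [star_trivial s]; exact Quaternion.star_smul s a⟩

/-- A transformation of functions that acts compatibly and boundedly on the pairs of transforms of
functions in `L¹ ∩ L²` acts in the same way on those of functions in `L²`. -/
theorem IsCosSinT.map {f P S f' P' S' : (ι → ℝ) → ℍ[ℝ]} (hf : IsCosSinT f P S)
    (U : ((ι → ℝ) → ℍ[ℝ]) → (ι → ℝ) → ℍ[ℝ]) {c : ℝ≥0∞} (hc : c ≠ ∞)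
    (hU : ∀ h, MemLp h 1 volume → MemLp h 2 volume → MemLp (U h) 1 volume ∧ MemLp (U h) 2 volume)
    (hf' : MemLp f' 2 volume) (hP' : MemLp P' 2 volume) (hS' : MemLp S' 2 volume)
    (h0 : ∀ h, MemLp h 1 volume → MemLp h 2 volume →
      eLpNorm (U h - f') 2 volume ≤ c * eLpNorm (h - f) 2 volume)
    (hC : ∀ h, MemLp h 1 volume → MemLp h 2 volume → eLpNorm (cosT (U h) - P') 2 volume ≤
      c * (eLpNorm (cosT h - P) 2 volume + eLpNorm (sinT h - S) 2 volume))
    (hS : ∀ h, MemLp h 1 volume → MemLp h 2 volume → eLpNorm (sinT (U h) - S') 2 volume ≤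
      c * (eLpNorm (cosT h - P) 2 volume + eLpNorm (sinT h - S) 2 volume)) :
    IsCosSinT f' P' S' := by
  obtain ⟨h, hh, t0, tc, ts⟩ := hf.exists_approx
  refine ⟨hf', hP', hS', fun k => U (h k), fun k => hU _ (hh k).1 (hh k).2, ?_, ?_, ?_⟩
  · exact tendsto_eLpNorm_of_le c hc t0 tendsto_const_nhds
      fun k => (h0 _ (hh k).1 (hh k).2).trans_eq (by rw [add_zero])
  · exact tendsto_eLpNorm_of_le c hc tc ts fun k => hC _ (hh k).1 (hh k).2
  · exact tendsto_eLpNorm_of_le c hc tc ts fun k => hS _ (hh k).1 (hh k).2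

theorem cosT_const_mul {h : (ι → ℝ) → ℍ[ℝ]} (hh : Integrable h) (q : ℍ[ℝ]) :
    cosT (fun x => q * h x) = fun w => q * cosT h w := by
  ext1 w
  have := (ContinuousLinearMap.mul ℝ ℍ[ℝ] q).integral_comp_comm (integrable_cos_smul hh w)
  simpa [cosT] using this

theorem sinT_const_mul {h : (ι → ℝ) → ℍ[ℝ]} (hh : Integrable h) (q : ℍ[ℝ]) :
    sinT (fun x => q * h x) = fun w => q * sinT h w := by
  ext1 w
  have := (ContinuousLinearMap.mul ℝ ℍ[ℝ] q).integral_comp_comm (integrable_sin_smul hh w)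
  simpa [sinT] using this

theorem memLp_const_mul {p : ℝ≥0∞} {h : (ι → ℝ) → ℍ[ℝ]} (hh : MemLp h p volume) (q : ℍ[ℝ]) :
    MemLp (fun x => q * h x) p volume :=
  (ContinuousLinearMap.mul ℝ ℍ[ℝ] q).comp_memLp' hh

theorem eLpNorm_const_mul_sub (q : ℍ[ℝ]) (a b : (ι → ℝ) → ℍ[ℝ]) :
    eLpNorm ((fun x => q * a x) - fun x => q * b x) 2 volume = ‖q‖ₑ * eLpNorm (a - b) 2 volume := by
  refine (ENNReal.pow_right_strictMono two_ne_zero).injective ?_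
  simp only [mul_pow, eLpNorm_two_sq, Pi.sub_apply, ← mul_sub, enorm_mul]
  exact lintegral_const_mul' _ _ (by finiteness)

theorem IsCosSinT.const_mul {f P S : (ι → ℝ) → ℍ[ℝ]} (hf : IsCosSinT f P S) (q : ℍ[ℝ]) :
    IsCosSinT (fun x => q * f x) (fun x => q * P x) (fun x => q * S x) := by
  refine hf.map (fun h x => q * h x) (c := ‖q‖ₑ) enorm_ne_top
    (fun h h1 h2 => ⟨memLp_const_mul h1 q, memLp_const_mul h2 q⟩) (memLp_const_mul hf.memLp q)
    (memLp_const_mul hf.memLp_cos q) (memLp_const_mul hf.memLp_sin q) ?_ ?_ ?_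
  · exact fun h _ _ => (eLpNorm_const_mul_sub _ _ _).le
  · intro h h1 _
    rw [cosT_const_mul (memLp_one_iff_integrable.1 h1), eLpNorm_const_mul_sub]
    gcongr
    exact le_self_add
  · intro h h1 _
    rw [sinT_const_mul (memLp_one_iff_integrable.1 h1), eLpNorm_const_mul_sub]
    gcongr
    exact le_add_self

theorem cosT_star_neg (h : (ι → ℝ) → ℍ[ℝ]) :
    cosT (fun x => star (h (-x))) = fun w => star (cosT h w) := by
  ext1 w
  have e := (starL' ℝ (A := ℍ[ℝ])).integral_comp_comm (μ := (volume : Measure (ι → ℝ)))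
    (fun z => Real.cos (2 * Real.pi * (w ⬝ᵥ z)) • h z)
  simp only [starL'_apply, star_smul, star_trivial] at e
  rw [cosT, cosT, ← e, ← integral_neg_eq_self]
  simp

theorem sinT_star_neg (h : (ι → ℝ) → ℍ[ℝ]) :
    sinT (fun x => star (h (-x))) = fun w => -star (sinT h w) := by
  ext1 w
  have e := (starL' ℝ (A := ℍ[ℝ])).integral_comp_comm (μ := (volume : Measure (ι → ℝ)))
    (fun z => Real.sin (2 * Real.pi * (w ⬝ᵥ z)) • h z)
  simp only [starL'_apply, star_smul, star_trivial] at e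
  rw [sinT, sinT, ← e, ← integral_neg_eq_self, ← integral_neg]
  simp

theorem memLp_star {p : ℝ≥0∞} {h : (ι → ℝ) → ℍ[ℝ]} (hh : MemLp h p volume) :
    MemLp (fun x => star (h x)) p volume :=
  ((starL' ℝ (A := ℍ[ℝ])) : ℍ[ℝ] →L[ℝ] ℍ[ℝ]).comp_memLp' hh

theorem memLp_comp_neg {p : ℝ≥0∞} {h : (ι → ℝ) → ℍ[ℝ]} (hh : MemLp h p volume) :
    MemLp (fun x => h (-x)) p volume :=
  hh.comp_measurePreserving (Measure.measurePreserving_neg _)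

theorem eLpNorm_congr_enorm {α G G' : Type*} [MeasurableSpace α] [NormedAddCommGroup G]
    [NormedAddCommGroup G'] {p : ℝ≥0∞} {μ : Measure α} {f : α → G} {g : α → G'}
    (h : ∀ x, ‖f x‖ = ‖g x‖) : eLpNorm f p μ = eLpNorm g p μ :=
  eLpNorm_congr_norm_ae (ae_of_all _ h)

/-- The transforms of `ψ*(x) = conj (ψ(-x))`. -/
theorem IsCosSinT.star_neg {f P S : (ι → ℝ) → ℍ[ℝ]} (hf : IsCosSinT f P S) :
    IsCosSinT (fun x => star (f (-x))) (fun x => star (P x)) (fun x => -star (S x)) := by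
  refine hf.map (fun h x => star (h (-x))) (c := 1) ENNReal.one_ne_top
    (fun h h1 h2 => ⟨memLp_star (memLp_comp_neg h1), memLp_star (memLp_comp_neg h2)⟩)
    (memLp_star (memLp_comp_neg hf.memLp)) (memLp_star hf.memLp_cos) (memLp_star hf.memLp_sin).neg
    ?_ ?_ ?_
  · intro h _ _
    rw [one_mul, ← eLpNorm_comp_neg (h - f)]
    refine (eLpNorm_congr_enorm fun x => ?_).le
    rw [Pi.sub_apply, Pi.sub_apply, ← star_sub, Quaternion.norm_star]
  · intro h _ _
    rw [one_mul, cosT_star_neg]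
    refine (eLpNorm_congr_enorm (g := cosT h - P) fun x => ?_).le.trans le_self_add
    rw [Pi.sub_apply, Pi.sub_apply, ← star_sub, Quaternion.norm_star]
  · intro h _ _
    rw [one_mul, sinT_star_neg]
    refine (eLpNorm_congr_enorm (g := sinT h - S) fun x => ?_).le.trans le_add_self
    rw [Pi.sub_apply, Pi.sub_apply, neg_sub_neg, ← star_sub, Quaternion.norm_star, norm_sub_rev]

theorem memLp_trig_smul {c : (ι → ℝ) → ℝ} (hc : Continuous c) (hc1 : ∀ x, |c x| ≤ 1)
    {h : (ι → ℝ) → ℍ[ℝ]} (hh : MemLp h 2 volume) : MemLp (fun x => c x • h x) 2 volume :=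
  hh.of_le (hc.aestronglyMeasurable.smul hh.1) (ae_of_all _ fun x => by
    rw [norm_smul]; exact mul_le_of_le_one_left (norm_nonneg _) (hc1 x))

theorem eLpNorm_trig_smul_le {c : (ι → ℝ) → ℝ} (hc1 : ∀ x, |c x| ≤ 1)
    (h : (ι → ℝ) → ℍ[ℝ]) : eLpNorm (fun x => c x • h x) 2 volume ≤ eLpNorm h 2 volume :=
  eLpNorm_mono fun x => by
    rw [norm_smul]; exact mul_le_of_le_one_left (norm_nonneg _) (hc1 x)

theorem cosT_translate {h : (ι → ℝ) → ℍ[ℝ]} (hh : Integrable h) (t : ι → ℝ) :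
    cosT (fun x => h (x - t)) = fun w => Real.cos (2 * Real.pi * (w ⬝ᵥ t)) • cosT h w -
      Real.sin (2 * Real.pi * (w ⬝ᵥ t)) • sinT h w := by
  ext1 w
  rw [cosT, cosT, sinT, ← integral_smul, ← integral_smul,
    ← integral_sub ((integrable_cos_smul hh w).fun_smul _) ((integrable_sin_smul hh w).fun_smul _),
    ← integral_add_right_eq_self _ t]
  refine integral_congr_ae (ae_of_all _ fun x => ?_)
  have e : 2 * Real.pi * (w ⬝ᵥ (x + t)) =
      2 * Real.pi * (w ⬝ᵥ t) + 2 * Real.pi * (w ⬝ᵥ x) := by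
    rw [dotProduct_add]; ring
  simp only [e, add_sub_cancel_right, Real.cos_add]
  module

theorem sinT_translate {h : (ι → ℝ) → ℍ[ℝ]} (hh : Integrable h) (t : ι → ℝ) :
    sinT (fun x => h (x - t)) = fun w => Real.sin (2 * Real.pi * (w ⬝ᵥ t)) • cosT h w +
      Real.cos (2 * Real.pi * (w ⬝ᵥ t)) • sinT h w := by
  ext1 w
  rw [cosT, sinT, sinT, ← integral_smul, ← integral_smul,
    ← integral_add ((integrable_cos_smul hh w).fun_smul _) ((integrable_sin_smul hh w).fun_smul _),
    ← integral_add_right_eq_self _ t]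
  refine integral_congr_ae (ae_of_all _ fun x => ?_)
  have e : 2 * Real.pi * (w ⬝ᵥ (x + t)) =
      2 * Real.pi * (w ⬝ᵥ t) + 2 * Real.pi * (w ⬝ᵥ x) := by
    rw [dotProduct_add]; ring
  simp only [e, add_sub_cancel_right, Real.sin_add]
  module

theorem IsCosSinT.translate {f P S : (ι → ℝ) → ℍ[ℝ]} (hf : IsCosSinT f P S) (t : ι → ℝ) :
    IsCosSinT (fun x => f (x - t))
      (fun w => Real.cos (2 * Real.pi * (w ⬝ᵥ t)) • P w - Real.sin (2 * Real.pi * (w ⬝ᵥ t)) • S w)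
      (fun w => Real.sin (2 * Real.pi * (w ⬝ᵥ t)) • P w +
        Real.cos (2 * Real.pi * (w ⬝ᵥ t)) • S w) := by
  have hd := continuous_dotProduct_right t
  have hc : Continuous fun w : ι → ℝ => Real.cos (2 * Real.pi * (w ⬝ᵥ t)) := by fun_prop
  have hs : Continuous fun w : ι → ℝ => Real.sin (2 * Real.pi * (w ⬝ᵥ t)) := by fun_prop
  have mp : MeasurePreserving (fun x : ι → ℝ => x - t) volume volume :=
    measurePreserving_sub_right _ t
  refine hf.map (fun h x => h (x - t)) (c := 1) ENNReal.one_ne_top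
    (fun h h1 h2 => ⟨h1.comp_measurePreserving mp, h2.comp_measurePreserving mp⟩)
    (hf.memLp.comp_measurePreserving mp)
    ((memLp_trig_smul hc (fun x => Real.abs_cos_le_one _) hf.memLp_cos).sub
      (memLp_trig_smul hs (fun x => Real.abs_sin_le_one _) hf.memLp_sin))
    ((memLp_trig_smul hs (fun x => Real.abs_sin_le_one _) hf.memLp_cos).add
      (memLp_trig_smul hc (fun x => Real.abs_cos_le_one _) hf.memLp_sin)) ?_ ?_ ?_
  · intro h _ h2
    rw [one_mul]
    exact (eLpNorm_comp_measurePreserving (h2.sub hf.memLp).1 mp).le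
  · intro h h1 h2
    have mc := (memLp_cosT h1 h2).sub hf.memLp_cos
    have ms := (memLp_sinT h1 h2).sub hf.memLp_sin
    rw [one_mul, cosT_translate (memLp_one_iff_integrable.1 h1)]
    have e : ((fun w => Real.cos (2 * Real.pi * (w ⬝ᵥ t)) • cosT h w -
          Real.sin (2 * Real.pi * (w ⬝ᵥ t)) • sinT h w) - fun w =>
          Real.cos (2 * Real.pi * (w ⬝ᵥ t)) • P w - Real.sin (2 * Real.pi * (w ⬝ᵥ t)) • S w) =
        (fun w => Real.cos (2 * Real.pi * (w ⬝ᵥ t)) • (cosT h - P) w) -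
          fun w => Real.sin (2 * Real.pi * (w ⬝ᵥ t)) • (sinT h - S) w := by
      ext1 w
      simp only [Pi.sub_apply]
      module
    rw [e]
    refine (eLpNorm_sub_le (memLp_trig_smul hc (fun x => Real.abs_cos_le_one _) mc).1
      (memLp_trig_smul hs (fun x => Real.abs_sin_le_one _) ms).1 one_le_two).trans ?_
    exact add_le_add (eLpNorm_trig_smul_le (fun x => Real.abs_cos_le_one _) _)
      (eLpNorm_trig_smul_le (fun x => Real.abs_sin_le_one _) _)
  · intro h h1 h2
    have mc := (memLp_cosT h1 h2).sub hf.memLp_cos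
    have ms := (memLp_sinT h1 h2).sub hf.memLp_sin
    rw [one_mul, sinT_translate (memLp_one_iff_integrable.1 h1)]
    have e : ((fun w => Real.sin (2 * Real.pi * (w ⬝ᵥ t)) • cosT h w +
          Real.cos (2 * Real.pi * (w ⬝ᵥ t)) • sinT h w) - fun w =>
          Real.sin (2 * Real.pi * (w ⬝ᵥ t)) • P w + Real.cos (2 * Real.pi * (w ⬝ᵥ t)) • S w) =
        (fun w => Real.sin (2 * Real.pi * (w ⬝ᵥ t)) • (cosT h - P) w) +
          fun w => Real.cos (2 * Real.pi * (w ⬝ᵥ t)) • (sinT h - S) w := by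
      ext1 w
      simp only [Pi.sub_apply, Pi.add_apply]
      module
    rw [e]
    refine (eLpNorm_add_le (memLp_trig_smul hs (fun x => Real.abs_sin_le_one _) mc).1
      (memLp_trig_smul hc (fun x => Real.abs_cos_le_one _) ms).1 one_le_two).trans ?_
    exact add_le_add (eLpNorm_trig_smul_le (fun x => Real.abs_sin_le_one _) _)
      (eLpNorm_trig_smul_le (fun x => Real.abs_cos_le_one _) _)

section Matrix

variable [DecidableEq ι]

theorem measurableEmbedding_mulVec {N : Matrix ι ι ℝ} (hN : N.det ≠ 0) :
    MeasurableEmbedding (fun x => N *ᵥ x) := by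
  have hu : IsUnit N.det := isUnit_iff_ne_zero.2 hN
  exact ((Matrix.toLinearEquiv' N (N.invertibleOfIsUnitDet hu)).toContinuousLinearEquiv
    |>.toHomeomorph).measurableEmbedding

theorem map_mulVec_volume {N : Matrix ι ι ℝ} (hN : N.det ≠ 0) :
    Measure.map (fun x => N *ᵥ x) (volume : Measure (ι → ℝ)) =
      ENNReal.ofReal |N.det|⁻¹ • volume := by
  have := Real.map_matrix_volume_pi_eq_smul_volume_pi hN
  rw [abs_inv] at this
  exact this

theorem lintegral_comp_mulVec {N : Matrix ι ι ℝ} (hN : N.det ≠ 0) (G : (ι → ℝ) → ℝ≥0∞) :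
    ∫⁻ x, G (N *ᵥ x) = ENNReal.ofReal |N.det|⁻¹ * ∫⁻ x, G x := by
  rw [← (measurableEmbedding_mulVec hN).lintegral_map, map_mulVec_volume hN, lintegral_smul_measure,
    smul_eq_mul]

theorem integral_comp_mulVec {N : Matrix ι ι ℝ} (hN : N.det ≠ 0) (G : (ι → ℝ) → ℍ[ℝ]) :
    ∫ x, G (N *ᵥ x) = |N.det|⁻¹ • ∫ x, G x := by
  rw [← (measurableEmbedding_mulVec hN).integral_map, map_mulVec_volume hN, integral_smul_measure,
    ENNReal.toReal_ofReal (by positivity)]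

theorem memLp_comp_mulVec {N : Matrix ι ι ℝ} (hN : N.det ≠ 0) {p : ℝ≥0∞} {G : (ι → ℝ) → ℍ[ℝ]}
    (hG : MemLp G p volume) : MemLp (fun x => G (N *ᵥ x)) p volume := by
  have := (measurableEmbedding_mulVec hN).memLp_map_measure_iff (g := G) (p := p)
    (μ := (volume : Measure (ι → ℝ)))
  refine this.1 ?_
  rw [map_mulVec_volume hN]
  exact hG.smul_measure ENNReal.ofReal_ne_top

theorem eLpNorm_comp_mulVec {N : Matrix ι ι ℝ} (hN : N.det ≠ 0) (G : (ι → ℝ) → ℍ[ℝ]) :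
    eLpNorm (fun x => G (N *ᵥ x)) 2 volume =
      ENNReal.ofReal (√|N.det|⁻¹) * eLpNorm G 2 volume := by
  refine (ENNReal.pow_right_strictMono two_ne_zero).injective ?_
  simp only [mul_pow, eLpNorm_two_sq]
  rw [lintegral_comp_mulVec hN (fun x => ‖G x‖ₑ ^ 2), ← ENNReal.ofReal_pow (by positivity),
    Real.sq_sqrt (by positivity)]

theorem cosT_comp_mulVec {N M : Matrix ι ι ℝ} (hN : N.det ≠ 0) (hMN : M * N = 1)
    (h : (ι → ℝ) → ℍ[ℝ]) :
    cosT (fun x => h (N *ᵥ x)) = fun w => |N.det|⁻¹ • cosT h (w ᵥ* M) := by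
  ext1 w
  rw [cosT, cosT, ← integral_comp_mulVec hN]
  simp [← Matrix.dotProduct_mulVec, Matrix.mulVec_mulVec, hMN]

theorem sinT_comp_mulVec {N M : Matrix ι ι ℝ} (hN : N.det ≠ 0) (hMN : M * N = 1)
    (h : (ι → ℝ) → ℍ[ℝ]) :
    sinT (fun x => h (N *ᵥ x)) = fun w => |N.det|⁻¹ • sinT h (w ᵥ* M) := by
  ext1 w
  rw [sinT, sinT, ← integral_comp_mulVec hN]
  simp [← Matrix.dotProduct_mulVec, Matrix.mulVec_mulVec, hMN]

/-- The transforms of `x ↦ f (N x)`, where `M` is the inverse of `N`. -/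
theorem IsCosSinT.comp_mulVec {f P S : (ι → ℝ) → ℍ[ℝ]} (hf : IsCosSinT f P S)
    {N M : Matrix ι ι ℝ} (hN : N.det ≠ 0) (hMN : M * N = 1) :
    IsCosSinT (fun x => f (N *ᵥ x)) (fun w => |N.det|⁻¹ • P (w ᵥ* M))
      (fun w => |N.det|⁻¹ • S (w ᵥ* M)) := by
  have hM : Mᵀ.det ≠ 0 := by
    rw [Matrix.det_transpose]
    intro h0
    have := congrArg Matrix.det hMN
    rw [Matrix.det_mul, h0, zero_mul, Matrix.det_one] at this
    exact zero_ne_one this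
  have hbound : ∀ a b : (ι → ℝ) → ℍ[ℝ],
      eLpNorm ((fun w => |N.det|⁻¹ • a (w ᵥ* M)) - fun w => |N.det|⁻¹ • b (w ᵥ* M)) 2 volume =
        ‖|N.det|⁻¹‖ₑ * ENNReal.ofReal (√|Mᵀ.det|⁻¹) * eLpNorm (a - b) 2 volume := by
    intro a b
    rw [mul_assoc, ← eLpNorm_comp_mulVec hM, ← eLpNorm_const_smul]
    congr 1
    ext1 w
    simp [Matrix.mulVec_transpose, smul_sub]
  have hmem : ∀ a : (ι → ℝ) → ℍ[ℝ], MemLp a 2 volume →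
      MemLp (fun w => |N.det|⁻¹ • a (w ᵥ* M)) 2 volume := by
    intro a ha
    have := (memLp_comp_mulVec hM ha).const_smul |N.det|⁻¹
    simp only [Matrix.mulVec_transpose] at this
    exact this
  refine hf.map (fun h x => h (N *ᵥ x))
    (c := max (‖|N.det|⁻¹‖ₑ * ENNReal.ofReal (√|Mᵀ.det|⁻¹)) (ENNReal.ofReal (√|N.det|⁻¹)))
    (by finiteness) (fun h h1 h2 => ⟨memLp_comp_mulVec hN h1, memLp_comp_mulVec hN h2⟩)
    (memLp_comp_mulVec hN hf.memLp) (hmem _ hf.memLp_cos) (hmem _ hf.memLp_sin) ?_ ?_ ?_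
  · intro h _ _
    refine (eLpNorm_comp_mulVec hN (h - f)).le.trans ?_
    gcongr
    exact le_max_right _ _
  · intro h _ _
    rw [cosT_comp_mulVec hN hMN, hbound]
    gcongr
    · exact le_max_left _ _
    · exact le_self_add
  · intro h _ _
    rw [sinT_comp_mulVec hN hMN, hbound]
    gcongr
    · exact le_max_left _ _
    · exact le_add_self

end Matrix

end

/-! ### Correlations -/

section

variable {ι : Type*} [Fintype ι]

theorem integrable_mul_star {f g : (ι → ℝ) → ℍ[ℝ]} (hf : MemLp f 2 volume)
    (hg : MemLp g 2 volume) : Integrable fun x => f x * star (g x) :=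
  hf.integrable_mul (memLp_star hg)

theorem inner_mul_star (q a b : ℍ[ℝ]) : inner ℝ q (a * star b) = inner ℝ (q * b) a := by
  simp [Quaternion.inner_def, mul_assoc]

/-- The quaternion-valued form of Parseval's identity. It follows from the scalar one because the
transforms commute with left multiplication by quaternions. -/
theorem IsCosSinT.integral_mul_star {f P S g Q T : (ι → ℝ) → ℍ[ℝ]} (hf : IsCosSinT f P S)
    (hg : IsCosSinT g Q T) :
    ∫ x, f x * star (g x) = ∫ w, (P w * star (Q w) + S w * star (T w)) := by
  refine ext_inner_left ℝ fun q => ?_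
  have iP := integrable_mul_star hf.memLp_cos hg.memLp_cos
  have iS := integrable_mul_star hf.memLp_sin hg.memLp_sin
  rw [integral_add iP iS, inner_add_right, ← _root_.integral_inner iP,
    ← _root_.integral_inner iS, ← _root_.integral_inner (integrable_mul_star hf.memLp hg.memLp)]
  simp only [inner_mul_star]
  exact (hg.const_mul q).integral_inner hf

/-- The real part of the product `(P - iS) (Q - iT)^*` in `ℍ ⊗ ℂ`. -/
noncomputable def crossRe (P S Q T : (ι → ℝ) → ℍ[ℝ]) (w : ι → ℝ) : ℍ[ℝ] :=
  P w * star (Q w) + S w * star (T w)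

/-- Minus the imaginary part of the product `(P - iS) (Q - iT)^*` in `ℍ ⊗ ℂ`. -/
noncomputable def crossIm (P S Q T : (ι → ℝ) → ℍ[ℝ]) (w : ι → ℝ) : ℍ[ℝ] :=
  S w * star (Q w) - P w * star (T w)

theorem integrable_crossRe {P S Q T : (ι → ℝ) → ℍ[ℝ]} (hP : MemLp P 2 volume)
    (hS : MemLp S 2 volume) (hQ : MemLp Q 2 volume) (hT : MemLp T 2 volume) :
    Integrable (crossRe P S Q T) :=
  (integrable_mul_star hP hQ).add (integrable_mul_star hS hT)

theorem integrable_crossIm {P S Q T : (ι → ℝ) → ℍ[ℝ]} (hP : MemLp P 2 volume)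
    (hS : MemLp S 2 volume) (hQ : MemLp Q 2 volume) (hT : MemLp T 2 volume) :
    Integrable (crossIm P S Q T) :=
  (integrable_mul_star hS hQ).sub (integrable_mul_star hP hT)

/-- The correlation of two square-integrable functions is the inverse Fourier transform of the
product of their transforms. -/
theorem IsCosSinT.correlation_eq {f P S g Q T : (ι → ℝ) → ℍ[ℝ]} (hf : IsCosSinT f P S)
    (hg : IsCosSinT g Q T) (t : ι → ℝ) :
    ∫ x, f x * star (g (x - t)) = cosT (crossRe P S Q T) t + sinT (crossIm P S Q T) t := by
  rw [hf.integral_mul_star (hg.translate t), cosT, sinT, ← integral_add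
    (integrable_cos_smul (integrable_crossRe hf.memLp_cos hf.memLp_sin hg.memLp_cos hg.memLp_sin) t)
    (integrable_sin_smul (integrable_crossIm hf.memLp_cos hf.memLp_sin hg.memLp_cos hg.memLp_sin) t)]
  refine integral_congr_ae (ae_of_all _ fun w => ?_)
  simp only [crossRe, crossIm, dotProduct_comm t w, star_add, star_sub, star_smul, star_trivial,
    mul_add, mul_sub, mul_smul_comm]
  module

theorem eq_zero_of_eq_neg {q : ℍ[ℝ]} (h : q = -q) : q = 0 := by
  have h2 : (2 : ℝ) • q = 0 := by
    rw [two_smul]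
    exact add_eq_zero_iff_eq_neg.2 h
  exact (smul_eq_zero.1 h2).resolve_left two_ne_zero

theorem cosT_eq_zero_of_odd {h : (ι → ℝ) → ℍ[ℝ]} (hh : ∀ x, h (-x) = -h x) : cosT h = 0 := by
  ext1 w
  rw [Pi.zero_apply]
  refine eq_zero_of_eq_neg ?_
  conv_lhs => rw [cosT, ← integral_neg_eq_self]
  rw [cosT, ← integral_neg]
  simp [hh]

theorem sinT_eq_zero_of_even {h : (ι → ℝ) → ℍ[ℝ]} (hh : ∀ x, h (-x) = h x) : sinT h = 0 := by
  ext1 w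
  rw [Pi.zero_apply]
  refine eq_zero_of_eq_neg ?_
  conv_lhs => rw [sinT, ← integral_neg_eq_self]
  rw [sinT, ← integral_neg]
  simp [hh]

theorem enorm_parallelogram (a b : ℍ[ℝ]) :
    ‖a + b‖ₑ ^ 2 + ‖a - b‖ₑ ^ 2 = 2 * (‖a‖ₑ ^ 2 + ‖b‖ₑ ^ 2) := by
  simp only [enorm_sq_eq_ofReal]
  rw [← ENNReal.ofReal_add (by positivity) (by positivity),
    ← ENNReal.ofReal_add (by positivity) (by positivity), ← ENNReal.ofReal_ofNat 2,
    ← ENNReal.ofReal_mul (by positivity)]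
  congr 1
  have := parallelogram_law_with_norm ℝ a b
  nlinarith

/-- If `A` is even and `B` is odd, then `cosT A` and `sinT B` are orthogonal in `L²`. -/
theorem lintegral_enorm_sq_cosT_add_sinT {A B : (ι → ℝ) → ℍ[ℝ]} (hA : ∀ x, A (-x) = A x)
    (hB : ∀ x, B (-x) = -B x) (hA1 : MemLp A 1 volume) (hA2 : MemLp A 2 volume)
    (hB1 : MemLp B 1 volume) (hB2 : MemLp B 2 volume) :
    ∫⁻ t, ‖cosT A t + sinT B t‖ₑ ^ 2 = (∫⁻ w, ‖A w‖ₑ ^ 2) + ∫⁻ w, ‖B w‖ₑ ^ 2 := by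
  have eA := plancherel_cosT_sinT hA1 hA2
  have eB := plancherel_cosT_sinT hB1 hB2
  rw [sinT_eq_zero_of_even hA, eLpNorm_zero, zero_pow two_ne_zero, add_zero, eLpNorm_two_sq,
    eLpNorm_two_sq] at eA
  rw [cosT_eq_zero_of_odd hB, eLpNorm_zero, zero_pow two_ne_zero, zero_add, eLpNorm_two_sq,
    eLpNorm_two_sq] at eB
  have cA := continuous_cosT (memLp_one_iff_integrable.1 hA1)
  have cB := continuous_sinT (memLp_one_iff_integrable.1 hB1)
  rw [← eA, ← eB, ← lintegral_add_left (cA.enorm.measurable.pow_const 2)]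
  refine (ENNReal.mul_right_inj two_ne_zero ENNReal.ofNat_ne_top).1 ?_
  have hneg : ∫⁻ t, ‖cosT A t + sinT B t‖ₑ ^ 2 = ∫⁻ t, ‖cosT A t - sinT B t‖ₑ ^ 2 := by
    rw [← lintegral_neg_eq_self]
    simp only [cosT_neg, sinT_neg, sub_eq_add_neg]
  rw [two_mul]
  nth_rewrite 2 [hneg]
  rw [← lintegral_add_left ((cA.fun_add cB).enorm.measurable.pow_const 2),
    ← lintegral_const_mul' _ _ ENNReal.ofNat_ne_top]
  exact lintegral_congr fun t => enorm_parallelogram _ _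

/-- The `L²` norm of a correlation, provided that the product of the transforms is in `L²`. -/
theorem IsCosSinT.lintegral_correlation {f P S g Q T : (ι → ℝ) → ℍ[ℝ]} (hf : IsCosSinT f P S)
    (hg : IsCosSinT g Q T) (hP : ∀ x, P (-x) = P x) (hS : ∀ x, S (-x) = -S x)
    (hQ : ∀ x, Q (-x) = Q x) (hT : ∀ x, T (-x) = -T x)
    (hfin : ∫⁻ w, (‖crossRe P S Q T w‖ₑ ^ 2 + ‖crossIm P S Q T w‖ₑ ^ 2) ≠ ∞) :
    ∫⁻ t, ‖∫ x, f x * star (g (x - t))‖ₑ ^ 2 =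
      ∫⁻ w, (‖crossRe P S Q T w‖ₑ ^ 2 + ‖crossIm P S Q T w‖ₑ ^ 2) := by
  have iR := integrable_crossRe hf.memLp_cos hf.memLp_sin hg.memLp_cos hg.memLp_sin
  have iI := integrable_crossIm hf.memLp_cos hf.memLp_sin hg.memLp_cos hg.memLp_sin
  have e : ∫⁻ w, (‖crossRe P S Q T w‖ₑ ^ 2 + ‖crossIm P S Q T w‖ₑ ^ 2) =
      (∫⁻ w, ‖crossRe P S Q T w‖ₑ ^ 2) + ∫⁻ w, ‖crossIm P S Q T w‖ₑ ^ 2 :=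
    lintegral_add_left' (iR.aestronglyMeasurable.enorm.pow_const 2) _
  have mem : ∀ {A : (ι → ℝ) → ℍ[ℝ]}, Integrable A → ∫⁻ w, ‖A w‖ₑ ^ 2 ≠ ∞ → MemLp A 2 volume := by
    intro A hA h
    refine ⟨hA.aestronglyMeasurable, ?_⟩
    rw [← eLpNorm_two_sq] at h
    exact lt_top_iff_ne_top.2 fun h' => h (by simp [h'])
  rw [e] at hfin ⊢
  simp only [hf.correlation_eq hg]
  refine lintegral_enorm_sq_cosT_add_sinT (fun x => ?_) (fun x => ?_)
    (memLp_one_iff_integrable.2 iR) (mem iR fun h => hfin (by simp [h]))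
    (memLp_one_iff_integrable.2 iI) (mem iI fun h => hfin (by simp [h]))
  · simp [crossRe, hP, hS, hQ, hT]
  · simp [crossIm, hP, hS, hQ, hT]
    abel

/-- Averaging over the sign of the imaginary part of the second factor makes the norm of the
product in `ℍ ⊗ ℂ` multiplicative: this is the parallelogram law. -/
theorem enorm_cross_add_cross_neg {α : Type*} (P S Q T : (α → ℝ) → ℍ[ℝ]) (w : α → ℝ) :
    (‖crossRe P S Q T w‖ₑ ^ 2 + ‖crossIm P S Q T w‖ₑ ^ 2) +
      (‖crossRe P S Q (-T) w‖ₑ ^ 2 + ‖crossIm P S Q (-T) w‖ₑ ^ 2) =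
    2 * ((‖P w‖ₑ ^ 2 + ‖S w‖ₑ ^ 2) * (‖Q w‖ₑ ^ 2 + ‖T w‖ₑ ^ 2)) := by
  have h1 := enorm_parallelogram (P w * star (Q w)) (S w * star (T w))
  have h2 := enorm_parallelogram (S w * star (Q w)) (P w * star (T w))
  have hs : ∀ q : ℍ[ℝ], ‖star q‖ₑ = ‖q‖ₑ := fun q => by
    rw [← ofReal_norm, Quaternion.norm_star, ofReal_norm]
  simp only [enorm_mul, mul_pow, hs] at h1 h2
  simp only [crossRe, crossIm, Pi.neg_apply, star_neg, mul_neg, sub_neg_eq_add, ← sub_eq_add_neg]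
  calc _ = (‖P w * star (Q w) + S w * star (T w)‖ₑ ^ 2 +
          ‖P w * star (Q w) - S w * star (T w)‖ₑ ^ 2) +
        (‖S w * star (Q w) + P w * star (T w)‖ₑ ^ 2 +
          ‖S w * star (Q w) - P w * star (T w)‖ₑ ^ 2) := by ring
    _ = _ := by rw [h1, h2]; ring

end

/-! ### The two-sided quaternion Fourier transform -/

section

/-- The reflection `(u, v) ↦ (u, -v)`. -/
def flipSnd {n : ℕ} (w : Fin (2 * n) → ℝ) : Fin (2 * n) → ℝ :=
  fun i => if i.val < n then w i else -w i

theorem flipSnd_neg {n : ℕ} (w : Fin (2 * n) → ℝ) : flipSnd (-w) = -flipSnd w := by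
  ext i
  by_cases h : i.val < n <;> simp [flipSnd, h]

theorem flipSnd_flipSnd {n : ℕ} (w : Fin (2 * n) → ℝ) : flipSnd (flipSnd w) = w := by
  ext i
  by_cases h : i.val < n <;> simp [flipSnd, h]

theorem measurePreserving_flipSnd (n : ℕ) :
    MeasurePreserving (flipSnd : (Fin (2 * n) → ℝ) → Fin (2 * n) → ℝ) volume volume := by
  have := volume_preserving_pi (ι := Fin (2 * n)) (α' := fun _ => ℝ) (β' := fun _ => ℝ)
    (f := fun i x => if i.val < n then x else -x) (fun i => by
      by_cases h : i.val < n
      · simp only [h, if_true]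
        exact MeasurePreserving.id _
      · simp only [h, if_false]
        exact Measure.measurePreserving_neg _)
  exact this

theorem dotProduct_eq_dotFst_add_dotSnd {n : ℕ} (w z : Fin (2 * n) → ℝ) :
    w ⬝ᵥ z = dotFst w z + dotSnd w z := by
  rw [dotProduct, ← (finCongr (two_mul n).symm).sum_comp, Fin.sum_univ_add]
  rfl

theorem flipSnd_dotProduct {n : ℕ} (w z : Fin (2 * n) → ℝ) :
    flipSnd w ⬝ᵥ z = dotFst w z - dotSnd w z := by
  rw [dotProduct_eq_dotFst_add_dotSnd, sub_eq_add_neg]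
  congr 1
  · simp [dotFst, flipSnd]
  · simp [dotSnd, flipSnd]

/-- The quaternion unit `i`. -/
def unitI : ℍ[ℝ] := ⟨0, 1, 0, 0⟩

/-- The quaternion unit `j`. -/
def unitJ : ℍ[ℝ] := ⟨0, 0, 1, 0⟩

theorem unitI_components :
    unitI.re = 0 ∧ unitI.imI = 1 ∧ unitI.imJ = 0 ∧ unitI.imK = 0 := ⟨rfl, rfl, rfl, rfl⟩

theorem unitJ_components :
    unitJ.re = 0 ∧ unitJ.imI = 0 ∧ unitJ.imJ = 1 ∧ unitJ.imK = 0 := ⟨rfl, rfl, rfl, rfl⟩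

theorem expI_eq (θ : ℝ) : expI θ = (Real.cos θ : ℍ[ℝ]) + Real.sin θ • unitI := by
  ext <;> simp [expI, unitI_components]

theorem expJ_eq (θ : ℝ) : expJ θ = (Real.cos θ : ℍ[ℝ]) + Real.sin θ • unitJ := by
  ext <;> simp [expJ, unitJ_components]

theorem norm_unitI_mul (q : ℍ[ℝ]) : ‖unitI * q‖ = ‖q‖ := by
  have h : ‖unitI‖ ^ 2 = 1 := by
    rw [norm_sq_quaternion]
    simp [unitI_components]
  rw [norm_mul, (pow_eq_one_iff_of_nonneg (norm_nonneg _) two_ne_zero).1 h, one_mul]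

theorem norm_mul_unitJ (q : ℍ[ℝ]) : ‖q * unitJ‖ = ‖q‖ := by
  have h : ‖unitJ‖ ^ 2 = 1 := by
    rw [norm_sq_quaternion]
    simp [unitJ_components]
  rw [norm_mul, (pow_eq_one_iff_of_nonneg (norm_nonneg _) two_ne_zero).1 h, mul_one]

/-- The quaternion Fourier transform expressed by the cosine transform `P` and the sine transform
`S`: the exponential `e^{-ia} q e^{-jb}` is a combination of the cosines and sines of `a + b` and
`a - b`, and `a - b` corresponds to the frequency `flipSnd w`. -/
noncomputable def qftComb {n : ℕ} (P S : (Fin (2 * n) → ℝ) → ℍ[ℝ]) (w : Fin (2 * n) → ℝ) : ℍ[ℝ] :=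
  (1 / 2 : ℝ) • ((P w + P (flipSnd w)) - unitI * (S w + S (flipSnd w)) -
    (S w - S (flipSnd w)) * unitJ + unitI * (P (flipSnd w) - P w) * unitJ)

theorem expI_mul_mul_expJ (a b : ℝ) (q : ℍ[ℝ]) :
    expI (-a) * q * expJ (-b) = (1 / 2 : ℝ) • ((Real.cos (a + b) • q + Real.cos (a - b) • q) -
      unitI * (Real.sin (a + b) • q + Real.sin (a - b) • q) -
      (Real.sin (a + b) • q - Real.sin (a - b) • q) * unitJ +
      unitI * (Real.cos (a - b) • q - Real.cos (a + b) • q) * unitJ) := by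
  rw [Real.cos_add, Real.cos_sub, Real.sin_add, Real.sin_sub, expI_eq, expJ_eq]
  simp only [Real.cos_neg, Real.sin_neg, add_mul, mul_add, sub_mul, mul_sub, add_smul, sub_smul,
    neg_smul, neg_mul, mul_neg, smul_mul_assoc, mul_smul_comm, Quaternion.coe_mul_eq_smul,
    Quaternion.mul_coe_eq_smul]
  module

theorem integral_qftComb_aux {α : Type*} [MeasurableSpace α] {μ : Measure α}
    {c₁ c₂ s₁ s₂ : α → ℍ[ℝ]} (h₁ : Integrable c₁ μ) (h₂ : Integrable c₂ μ) (k₁ : Integrable s₁ μ)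
    (k₂ : Integrable s₂ μ) :
    ∫ z, ((c₁ z + c₂ z) - unitI * (s₁ z + s₂ z) - (s₁ z - s₂ z) * unitJ +
        unitI * (c₂ z - c₁ z) * unitJ) ∂μ =
      ((∫ z, c₁ z ∂μ) + ∫ z, c₂ z ∂μ) - unitI * ((∫ z, s₁ z ∂μ) + ∫ z, s₂ z ∂μ) -
        ((∫ z, s₁ z ∂μ) - ∫ z, s₂ z ∂μ) * unitJ +
        unitI * ((∫ z, c₂ z ∂μ) - ∫ z, c₁ z ∂μ) * unitJ := by
  have a₁ : Integrable (fun z => c₁ z + c₂ z) μ := h₁.add h₂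
  have a₂ : Integrable (fun z => s₁ z + s₂ z) μ := k₁.add k₂
  have a₃ : Integrable (fun z => s₁ z - s₂ z) μ := k₁.sub k₂
  have a₄ : Integrable (fun z => c₂ z - c₁ z) μ := h₂.sub h₁
  have b₂ : Integrable (fun z => unitI * (s₁ z + s₂ z)) μ := a₂.const_mul _
  have b₃ : Integrable (fun z => (s₁ z - s₂ z) * unitJ) μ := a₃.mul_const _
  have b₄ : Integrable (fun z => unitI * (c₂ z - c₁ z)) μ := a₄.const_mul _
  have d₁ : Integrable (fun z => (c₁ z + c₂ z) - unitI * (s₁ z + s₂ z)) μ := a₁.sub b₂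
  have d₂ : Integrable (fun z => (c₁ z + c₂ z) - unitI * (s₁ z + s₂ z) - (s₁ z - s₂ z) * unitJ) μ :=
    d₁.sub b₃
  rw [integral_add d₂ (b₄.mul_const _), integral_sub d₁ b₃, integral_sub a₁ b₂,
    integral_add h₁ h₂, integral_const_mul_of_integrable a₂, integral_add k₁ k₂,
    integral_mul_const_of_integrable a₃, integral_sub k₁ k₂,
    integral_mul_const_of_integrable b₄, integral_const_mul_of_integrable a₄, integral_sub h₂ h₁]

/-- The quaternion Fourier transform of an integrable function, in terms of the cosine and the sine
transform. -/
theorem qft_eq_qftComb {n : ℕ} {h : (Fin (2 * n) → ℝ) → ℍ[ℝ]} (hh : Integrable h) :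
    qft h = qftComb (cosT h) (sinT h) := by
  ext1 w
  have c1 := integrable_cos_smul hh w
  have c2 := integrable_cos_smul hh (flipSnd w)
  have s1 := integrable_sin_smul hh w
  have s2 := integrable_sin_smul hh (flipSnd w)
  have e1 : ∀ z, 2 * Real.pi * (w ⬝ᵥ z) =
      2 * Real.pi * dotFst w z + 2 * Real.pi * dotSnd w z := fun z => by
    rw [dotProduct_eq_dotFst_add_dotSnd]; ring
  have e2 : ∀ z, 2 * Real.pi * (flipSnd w ⬝ᵥ z) =
      2 * Real.pi * dotFst w z - 2 * Real.pi * dotSnd w z := fun z => by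
    rw [flipSnd_dotProduct]; ring
  have key : ∀ z, expI (-2 * Real.pi * dotFst w z) * h z * expJ (-2 * Real.pi * dotSnd w z) = _ :=
    fun z => (congrArg₂ (fun a b => expI a * h z * expJ b) (by ring) (by ring)).trans
      (expI_mul_mul_expJ (2 * Real.pi * dotFst w z) (2 * Real.pi * dotSnd w z) (h z))
  simp only [← e1, ← e2] at key
  rw [qft, qftComb, integral_congr_ae (ae_of_all _ key), integral_smul]
  rw [integral_qftComb_aux c1 c2 s1 s2]
  rfl

theorem qftComb_sub {n : ℕ} (P S Q T : (Fin (2 * n) → ℝ) → ℍ[ℝ]) :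
    qftComb (P - Q) (S - T) = qftComb P S - qftComb Q T := by
  ext1 w
  simp only [qftComb, Pi.sub_apply, ← smul_sub]
  congr 1
  simp only [mul_add, mul_sub, sub_mul]
  abel

theorem stronglyMeasurable_qftComb {n : ℕ} {P S : (Fin (2 * n) → ℝ) → ℍ[ℝ]}
    (hP : StronglyMeasurable P) (hS : StronglyMeasurable S) :
    StronglyMeasurable (qftComb P S) := by
  have hρ := (measurePreserving_flipSnd n).measurable
  have hP' := hP.comp_measurable hρ
  have hS' := hS.comp_measurable hρ
  exact (((((hP.add hP').sub ((hS.add hS').const_mul _)).sub ((hS.sub hS').mul_const _)).add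
    (((hP'.sub hP).const_mul _).mul_const _)).const_smul (1 / 2 : ℝ))

/-- Summing over the four sign changes of `u` and `v` cancels all cross terms. -/
theorem sum_flip_enorm_sq_qftComb {n : ℕ} {P S : (Fin (2 * n) → ℝ) → ℍ[ℝ]}
    (hP : ∀ x, P (-x) = P x) (hS : ∀ x, S (-x) = -S x) (w : Fin (2 * n) → ℝ) :
    ‖qftComb P S w‖ₑ ^ 2 + ‖qftComb P S (flipSnd w)‖ₑ ^ 2 +
      (‖qftComb P S (-w)‖ₑ ^ 2 + ‖qftComb P S (flipSnd (-w))‖ₑ ^ 2) =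
    2 * ((‖P w‖ₑ ^ 2 + ‖S w‖ₑ ^ 2) + (‖P (flipSnd w)‖ₑ ^ 2 + ‖S (flipSnd w)‖ₑ ^ 2)) := by
  have half : ∀ x : ℍ[ℝ], ‖(1 / 2 : ℝ) • x‖ ^ 2 = ‖x‖ ^ 2 / 4 := fun x => by
    rw [norm_smul, mul_pow]
    norm_num
    ring
  have par : ∀ x y : ℍ[ℝ], ‖x + y‖ ^ 2 + ‖x - y‖ ^ 2 = 2 * (‖x‖ ^ 2 + ‖y‖ ^ 2) := fun x y => by
    linarith [parallelogram_law_with_norm ℝ x y, sq ‖x + y‖, sq ‖x - y‖, sq ‖x‖, sq ‖y‖]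
  -- the four values are `(a ∓ b ∓ d ± e) / 2` with these `a`, `b`, `d`, `e`
  set a := P w + P (flipSnd w) with ha
  set b := unitI * (S w + S (flipSnd w)) with hb
  set d := (S w - S (flipSnd w)) * unitJ with hd
  set e := unitI * (P (flipSnd w) - P w) * unitJ with he
  have e1 : qftComb P S w = (1 / 2 : ℝ) • ((a - b) - (d - e)) := by
    rw [qftComb, ← ha, ← hb, ← hd, ← he]
    congr 1
    abel
  have e2 : qftComb P S (flipSnd w) = (1 / 2 : ℝ) • ((a - b) + (d - e)) := by
    rw [qftComb, flipSnd_flipSnd]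
    congr 1
    rw [ha, hb, hd, he]
    simp only [mul_add, mul_sub, sub_mul]
    abel
  have e3 : qftComb P S (-w) = (1 / 2 : ℝ) • ((a + b) + (d + e)) := by
    rw [qftComb, flipSnd_neg, hP, hP, hS, hS]
    congr 1
    rw [ha, hb, hd, he]
    simp only [mul_add, mul_sub, sub_mul, mul_neg, neg_mul]
    abel
  have e4 : qftComb P S (flipSnd (-w)) = (1 / 2 : ℝ) • ((a + b) - (d + e)) := by
    rw [qftComb, flipSnd_flipSnd, flipSnd_neg, hP, hP, hS, hS]
    congr 1
    rw [ha, hb, hd, he]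
    simp only [mul_add, mul_sub, sub_mul, mul_neg, neg_mul]
    abel
  have nb : ‖b‖ = ‖S w + S (flipSnd w)‖ := norm_unitI_mul _
  have nd : ‖d‖ = ‖S w - S (flipSnd w)‖ := norm_mul_unitJ _
  have ne : ‖e‖ = ‖P w - P (flipSnd w)‖ := by
    rw [he, norm_mul_unitJ, norm_unitI_mul, norm_sub_rev]
  have real : ‖qftComb P S w‖ ^ 2 + ‖qftComb P S (flipSnd w)‖ ^ 2 +
      (‖qftComb P S (-w)‖ ^ 2 + ‖qftComb P S (flipSnd (-w))‖ ^ 2) =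
      2 * ((‖P w‖ ^ 2 + ‖S w‖ ^ 2) + (‖P (flipSnd w)‖ ^ 2 + ‖S (flipSnd w)‖ ^ 2)) := by
    rw [e1, e2, e3, e4]
    simp only [half]
    have p5 := par (P w) (P (flipSnd w))
    have p6 := par (S w) (S (flipSnd w))
    rw [← ha, ← ne] at p5
    rw [← nb, ← nd] at p6
    linarith [par (a - b) (d - e), par (a + b) (d + e), par a b, par d e]
  have cast := congrArg ENNReal.ofReal real
  rw [ENNReal.ofReal_mul (by positivity)] at cast
  repeat rw [ENNReal.ofReal_add (by positivity) (by positivity)] at cast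
  simpa only [enorm_sq_eq_ofReal, ENNReal.ofReal_ofNat] using cast

/-- A weight that is invariant under the sign changes of `u` and `v` does not see the difference
between the quaternion Fourier transform and the pair of the cosine and the sine transform. -/
theorem lintegral_enorm_sq_qftComb_mul {n : ℕ} {P S : (Fin (2 * n) → ℝ) → ℍ[ℝ]}
    (hPm : StronglyMeasurable P) (hSm : StronglyMeasurable S)
    (hP : ∀ x, P (-x) = P x) (hS : ∀ x, S (-x) = -S x) {W : (Fin (2 * n) → ℝ) → ℝ≥0∞}
    (hW : Measurable W) (hWn : ∀ x, W (-x) = W x) (hWf : ∀ x, W (flipSnd x) = W x) :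
    ∫⁻ w, ‖qftComb P S w‖ₑ ^ 2 * W w = ∫⁻ w, (‖P w‖ₑ ^ 2 + ‖S w‖ₑ ^ 2) * W w := by
  have hρ := measurePreserving_flipSnd n
  set A : (Fin (2 * n) → ℝ) → ℝ≥0∞ := fun w => ‖qftComb P S w‖ₑ ^ 2 * W w with hA
  set B : (Fin (2 * n) → ℝ) → ℝ≥0∞ := fun w => (‖P w‖ₑ ^ 2 + ‖S w‖ₑ ^ 2) * W w with hB
  have mA : Measurable A :=
    ((stronglyMeasurable_qftComb hPm hSm).enorm.pow_const 2).mul hW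
  have mB : Measurable B := ((hPm.enorm.pow_const 2).add (hSm.enorm.pow_const 2)).mul hW
  have flip : ∀ {F : (Fin (2 * n) → ℝ) → ℝ≥0∞}, Measurable F →
      ∫⁻ w, F (flipSnd w) = ∫⁻ w, F w := fun hF => hρ.lintegral_comp hF
  have key : ∀ w, (A w + A (flipSnd w)) + (A (-w) + A (flipSnd (-w))) =
      2 * (B w + B (flipSnd w)) := by
    intro w
    have := congrArg (· * W w) (sum_flip_enorm_sq_qftComb hP hS w)
    simp only [hA, hB, flipSnd_neg, hWn, hWf] at this ⊢
    calc _ = _ := by ring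
      _ = _ := this
      _ = _ := by ring
  have mAf := mA.comp hρ.measurable
  have i1 : ∫⁻ w, (A w + A (flipSnd w)) = 2 * ∫⁻ w, A w := by
    rw [lintegral_add_left mA, flip mA,
      two_mul (∫⁻ w, A w)]
  have i2 : ∫⁻ w, (A (-w) + A (flipSnd (-w))) = 2 * ∫⁻ w, A w := by
    rw [lintegral_neg_eq_self fun w => A w + A (flipSnd w), i1]
  have i3 : ∫⁻ w, 2 * (B w + B (flipSnd w)) = 2 * (2 * ∫⁻ w, B w) := by
    rw [lintegral_const_mul' _ _ ENNReal.ofNat_ne_top, lintegral_add_left mB, flip mB,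
      two_mul (∫⁻ w, B w)]
  have tot := lintegral_congr (μ := (volume : Measure (Fin (2 * n) → ℝ))) key
  rw [lintegral_add_left (f := fun w => A w + A (flipSnd w)) (mA.add mAf), i1, i2, i3,
    ← two_mul (2 * ∫⁻ w, A w)] at tot
  have two_inj := fun {a b : ℝ≥0∞} =>
    (ENNReal.mul_right_inj (b := a) (c := b) two_ne_zero ENNReal.ofNat_ne_top).1
  exact two_inj (two_inj tot)

theorem eLpNorm_qftComb_sq {n : ℕ} {P S : (Fin (2 * n) → ℝ) → ℍ[ℝ]}
    (hPm : StronglyMeasurable P) (hSm : StronglyMeasurable S)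
    (hP : ∀ x, P (-x) = P x) (hS : ∀ x, S (-x) = -S x) :
    eLpNorm (qftComb P S) 2 volume ^ 2 = eLpNorm P 2 volume ^ 2 + eLpNorm S 2 volume ^ 2 := by
  have := lintegral_enorm_sq_qftComb_mul hPm hSm hP hS (W := fun _ => 1) measurable_const
    (fun _ => rfl) (fun _ => rfl)
  simp only [mul_one] at this
  rw [eLpNorm_two_sq, this, lintegral_add_left (hPm.enorm.pow_const 2), eLpNorm_two_sq,
    eLpNorm_two_sq]

/-- Plancherel's theorem for the quaternion Fourier transform. -/
theorem eLpNorm_qft {n : ℕ} {h : (Fin (2 * n) → ℝ) → ℍ[ℝ]} (h1 : MemLp h 1 volume)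
    (h2 : MemLp h 2 volume) : eLpNorm (qft h) 2 volume = eLpNorm h 2 volume := by
  have hint := memLp_one_iff_integrable.1 h1
  refine (ENNReal.pow_right_strictMono two_ne_zero).injective ?_
  rw [qft_eq_qftComb hint, eLpNorm_qftComb_sq (continuous_cosT hint).stronglyMeasurable
    (continuous_sinT hint).stronglyMeasurable (cosT_neg h) (sinT_neg h), plancherel_cosT_sinT h1 h2]

theorem qft_sub {n : ℕ} {g h : (Fin (2 * n) → ℝ) → ℍ[ℝ]} (hg : Integrable g) (hh : Integrable h) :
    qft (g - h) = qft g - qft h := by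
  rw [qft_eq_qftComb hg, qft_eq_qftComb hh, qft_eq_qftComb (hg.sub hh), cosT_sub hg hh,
    sinT_sub hg hh, qftComb_sub]

theorem IsCosSinT.isQFT {n : ℕ} {f P S : (Fin (2 * n) → ℝ) → ℍ[ℝ]} (hf : IsCosSinT f P S)
    (hPm : StronglyMeasurable P) (hSm : StronglyMeasurable S)
    (hP : ∀ x, P (-x) = P x) (hS : ∀ x, S (-x) = -S x) : IsQFT f (qftComb P S) := by
  have hle : ∀ {Q T : (Fin (2 * n) → ℝ) → ℍ[ℝ]}, StronglyMeasurable Q → StronglyMeasurable T →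
      (∀ x, Q (-x) = Q x) → (∀ x, T (-x) = -T x) →
      eLpNorm (qftComb Q T) 2 volume ≤ 1 * (eLpNorm Q 2 volume + eLpNorm T 2 volume) := by
    intro Q T hQm hTm hQ hT
    rw [one_mul, ← ENNReal.pow_le_pow_left_iff two_ne_zero, eLpNorm_qftComb_sq hQm hTm hQ hT,
      add_sq]
    gcongr
    exact le_self_add
  obtain ⟨h, hh, t0, tc, ts⟩ := hf.exists_approx
  refine ⟨⟨(stronglyMeasurable_qftComb hPm hSm).aestronglyMeasurable, ?_⟩, h, hh, t0, ?_⟩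
  · refine (hle hPm hSm hP hS).trans_lt ?_
    rw [one_mul]
    exact ENNReal.add_lt_top.2 ⟨hf.memLp_cos.2, hf.memLp_sin.2⟩
  · refine tendsto_eLpNorm_of_le 1 ENNReal.one_ne_top tc ts fun k => ?_
    have hint := memLp_one_iff_integrable.1 (hh k).1
    rw [qft_eq_qftComb hint, ← qftComb_sub]
    refine hle ((continuous_cosT hint).stronglyMeasurable.sub hPm)
      ((continuous_sinT hint).stronglyMeasurable.sub hSm) (fun x => ?_) (fun x => ?_)
    · simp [cosT_neg, hP]
    · simp [sinT_neg, hS]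
      abel

/-- The `L²` quaternion Fourier transform is determined up to a null set, so that the representative
chosen in `qftL2` may be replaced by any other. -/
theorem IsQFT.ae_eq {n : ℕ} {g G G' : (Fin (2 * n) → ℝ) → ℍ[ℝ]} (hG : IsQFT g G)
    (hG' : IsQFT g G') (hg : MemLp g 2 volume) : G =ᵐ[volume] G' := by
  obtain ⟨mG, u, hu, u0, uG⟩ := hG
  obtain ⟨mG', v, hv, v0, vG⟩ := hG'
  have mq : ∀ {h : (Fin (2 * n) → ℝ) → ℍ[ℝ]}, MemLp h 1 volume → MemLp h 2 volume →
      AEStronglyMeasurable (qft h) volume := by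
    intro h h1 _
    have hint := memLp_one_iff_integrable.1 h1
    rw [qft_eq_qftComb hint]
    exact (stronglyMeasurable_qftComb (continuous_cosT hint).stronglyMeasurable
      (continuous_sinT hint).stronglyMeasurable).aestronglyMeasurable
  have bound : ∀ k, eLpNorm (G - G') 2 volume ≤
      (eLpNorm (qft (u k) - G) 2 volume + eLpNorm (qft (v k) - G') 2 volume) +
      (eLpNorm (u k - g) 2 volume + eLpNorm (v k - g) 2 volume) := by
    intro k
    have m1 := (mq (hu k).1 (hu k).2).sub mG.1
    have m2 := (mq (hv k).1 (hv k).2).sub mG'.1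
    have m3 := (mq (hu k).1 (hu k).2).sub (mq (hv k).1 (hv k).2)
    have e : G - G' = ((qft (v k) - G') - (qft (u k) - G)) + (qft (u k) - qft (v k)) := by abel
    have e' : u k - v k = (u k - g) - (v k - g) := by abel
    calc eLpNorm (G - G') 2 volume
        ≤ eLpNorm ((qft (v k) - G') - (qft (u k) - G)) 2 volume +
            eLpNorm (qft (u k) - qft (v k)) 2 volume := by
          rw [e]
          exact eLpNorm_add_le (m2.sub m1) m3 one_le_two
      _ ≤ _ := by
          refine add_le_add ?_ ?_
          · rw [add_comm (eLpNorm (qft (u k) - G) 2 volume)]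
            exact eLpNorm_sub_le m2 m1 one_le_two
          · rw [← qft_sub (memLp_one_iff_integrable.1 (hu k).1)
              (memLp_one_iff_integrable.1 (hv k).1),
              eLpNorm_qft ((hu k).1.sub (hv k).1) ((hu k).2.sub (hv k).2), e']
            exact eLpNorm_sub_le ((hu k).2.sub hg).1 ((hv k).2.sub hg).1 one_le_two
  have lim := (uG.add vG).add (u0.add v0)
  simp only [add_zero] at lim
  have h0 : eLpNorm (G - G') 2 volume = 0 :=
    le_antisymm (ge_of_tendsto' lim bound) zero_le
  rw [eLpNorm_eq_zero_iff (mG.sub mG').1 two_ne_zero] at h0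
  exact h0.mono fun x hx => sub_eq_zero.1 hx

/-- The admissibility constant in terms of the cosine and sine transforms of `ψ`. -/
theorem admissibilityConst_eq {n : ℕ} [NeZero n] {ψ P S : (Fin (2 * n) → ℝ) → ℍ[ℝ]}
    (hψ : IsCosSinT ψ P S) (hPm : StronglyMeasurable P) (hSm : StronglyMeasurable S)
    (hP : ∀ x, P (-x) = P x) (hS : ∀ x, S (-x) = -S x) :
    admissibilityConst ψ = ∫⁻ l, (‖P l‖ₑ ^ 2 + ‖S l‖ₑ ^ 2) * (‖l 0‖ₑ ^ (2 * n))⁻¹ := by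
  have hs := hψ.star_neg
  have hPm' : StronglyMeasurable fun x => star (P x) := continuous_star.comp_stronglyMeasurable hPm
  have hSm' : StronglyMeasurable fun x => -star (S x) :=
    (continuous_star.comp_stronglyMeasurable hSm).neg
  have hP' : ∀ x, star (P (-x)) = star (P x) := fun x => by rw [hP]
  have hS' : ∀ x, -star (S (-x)) = - -star (S x) := fun x => by rw [hS, star_neg]
  have hq := hs.isQFT hPm' hSm' hP' hS'
  have hae : qftL2 (fun x => star (ψ (-x))) =ᵐ[volume] _ :=
    (Classical.epsilon_spec (p := IsQFT fun x => star (ψ (-x))) ⟨_, hq⟩).ae_eq hq hs.memLp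
  have hn : 0 < n := Nat.pos_of_ne_zero (NeZero.ne n)
  have hstar : ∀ q : ℍ[ℝ], ‖star q‖ₑ = ‖q‖ₑ := fun q => by
    rw [← ofReal_norm, Quaternion.norm_star, ofReal_norm]
  calc admissibilityConst ψ = ∫⁻ l, ‖qftComb (fun x => star (P x)) (fun x => -star (S x)) l‖ₑ ^ 2 *
        (‖l 0‖ₑ ^ (2 * n))⁻¹ := by
        refine lintegral_congr_ae (hae.mono fun l hl => ?_)
        simp only [hl, div_eq_mul_inv]
    _ = _ := by
        rw [lintegral_enorm_sq_qftComb_mul (W := fun l => (‖l 0‖ₑ ^ (2 * n))⁻¹) hPm' hSm' hP' hS'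
          (((measurable_pi_apply 0).enorm.pow_const _).inv) (fun x => by simp)
          (fun x => by simp [flipSnd, hn])]
        simp only [enorm_neg, hstar]

end

/-! ### The shearlet group acting on frequencies -/

section

/-- The vector of length `k` with first entry `x` and remaining entries `y`. -/
def consVec {k : ℕ} (x : ℝ) (y : Fin (k - 1) → ℝ) : Fin k → ℝ :=
  fun i => if h : i.val = 0 then x else y ⟨i.val - 1, by omega⟩

theorem measurePreserving_consVec (k : ℕ) [NeZero k] :
    MeasurePreserving (fun p : ℝ × (Fin (k - 1) → ℝ) => (consVec p.1 p.2 : Fin k → ℝ))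
      (volume.prod volume) volume := by
  obtain ⟨m, rfl⟩ : ∃ m, k = m + 1 := Nat.exists_eq_succ_of_ne_zero (NeZero.ne k)
  have h := (volume_preserving_piFinSuccAbove (fun _ : Fin (m + 1) => ℝ) 0).symm
  have e : (fun p : ℝ × (Fin (m + 1 - 1) → ℝ) => (consVec p.1 p.2 : Fin (m + 1) → ℝ)) =
      (MeasurableEquiv.piFinSuccAbove (fun _ : Fin (m + 1) => ℝ) 0).symm := by
    ext p i
    refine Fin.cases ?_ (fun j => ?_) i
    · simp [consVec, MeasurableEquiv.piFinSuccAbove]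
    · simp [consVec, MeasurableEquiv.piFinSuccAbove]
  rw [e]
  exact h

variable {n : ℕ}

/-- The entry `sg(a)|a|^{1/(2n)}` of the dilation matrix. -/
noncomputable def scaleFactor (n : ℕ) (a : ℝ) : ℝ :=
  Real.sign a * |a| ^ ((1 : ℝ) / (2 * (n : ℝ)))

/-- The absolute value of the determinant of the dilation matrix. -/
noncomputable def dilationJac (n : ℕ) (a : ℝ) : ℝ :=
  |a| * |scaleFactor n a| ^ (2 * n - 1)

theorem prod_ite_val_eq_zero (k : ℕ) [NeZero k] (a c : ℝ) :
    ∏ i : Fin k, (if i.val = 0 then a else c) = a * c ^ (k - 1) := by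
  obtain ⟨m, rfl⟩ : ∃ m, k = m + 1 := Nat.exists_eq_succ_of_ne_zero (NeZero.ne k)
  simp [Fin.prod_univ_succ]

theorem neZero_two_mul (n : ℕ) [NeZero n] : NeZero (2 * n) :=
  ⟨by have := NeZero.ne n; omega⟩

theorem abs_det_dilationMatrix [NeZero n] (a : ℝ) :
    |(dilationMatrix n a).det| = dilationJac n a := by
  have := neZero_two_mul n
  rw [dilationMatrix, Matrix.det_diagonal, prod_ite_val_eq_zero, abs_mul, abs_pow]
  rfl

theorem det_shearMatrix (s : Fin (2 * n - 1) → ℝ) : (shearMatrix n s).det = 1 := by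
  rw [Matrix.det_of_isUpperTriangular]
  · simp [shearMatrix]
  · intro i j hij
    have hij' : j < i := hij
    have h1 : i ≠ j := hij'.ne'
    have h2 : ¬ (i.val = 0 ∧ j.val ≠ 0) := by
      have : j.val < i.val := hij'
      omega
    simp [shearMatrix, h1, h2]

theorem abs_sign_of_ne_zero {a : ℝ} (ha : a ≠ 0) : |Real.sign a| = 1 := by
  rcases Real.sign_apply_eq_of_ne_zero a ha with h | h <;> simp [h]

theorem abs_scaleFactor {a : ℝ} (ha : a ≠ 0) :
    |scaleFactor n a| = |a| ^ ((1 : ℝ) / (2 * (n : ℝ))) := by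
  rw [scaleFactor, abs_mul, abs_sign_of_ne_zero ha, one_mul,
    abs_of_nonneg (Real.rpow_nonneg (abs_nonneg a) _)]

theorem scaleFactor_ne_zero {a : ℝ} (ha : a ≠ 0) : scaleFactor n a ≠ 0 := by
  rw [← abs_pos, abs_scaleFactor ha]
  exact Real.rpow_pos_of_pos (abs_pos.2 ha) _

theorem scaleFactor_neg (a : ℝ) : scaleFactor n (-a) = -scaleFactor n a := by
  simp [scaleFactor, Real.sign_neg]

theorem dilationJac_neg (a : ℝ) : dilationJac n (-a) = dilationJac n a := by
  simp [dilationJac, scaleFactor_neg]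

theorem dilationJac_pos {a : ℝ} (ha : a ≠ 0) : 0 < dilationJac n a :=
  mul_pos (abs_pos.2 ha) (pow_pos (abs_pos.2 (scaleFactor_ne_zero ha)) _)

/-- The normalizing factor of the shearlets makes the dilations isometric on `L²`. -/
theorem rpow_sq_mul_dilationJac [NeZero n] {a : ℝ} (ha : a ≠ 0) :
    (|a| ^ ((1 : ℝ) / (4 * (n : ℝ)) - 1)) ^ 2 * dilationJac n a = 1 := by
  have hn : (n : ℝ) ≠ 0 := Nat.cast_ne_zero.2 (NeZero.ne n)
  have hn1 : 1 ≤ 2 * n := by have := NeZero.ne n; omega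
  have hpos := abs_pos.2 ha
  rw [dilationJac, abs_scaleFactor ha, ← Real.rpow_natCast, ← Real.rpow_natCast,
    ← Real.rpow_mul hpos.le, ← Real.rpow_mul hpos.le, Nat.cast_sub hn1]
  nth_rewrite 2 [← Real.rpow_one |a|]
  rw [← Real.rpow_add hpos, ← Real.rpow_add hpos]
  convert Real.rpow_zero |a|
  push_cast
  field_simp
  ring

/-- The action of the transpose of `S_s A_a` on frequencies. -/
noncomputable def freqMap [NeZero n] (a : ℝ) (s : Fin (2 * n - 1) → ℝ)
    (w : Fin (2 * n) → ℝ) : Fin (2 * n) → ℝ :=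
  consVec (a * w 0)
    (scaleFactor n a • ((fun j : Fin (2 * n - 1) => w ⟨j.val + 1, by omega⟩) + w 0 • s))

theorem vecMul_shearMatrix_mul_dilationMatrix [NeZero n] (a : ℝ) (s : Fin (2 * n - 1) → ℝ)
    (w : Fin (2 * n) → ℝ) : w ᵥ* (shearMatrix n s * dilationMatrix n a) = freqMap a s w := by
  ext j
  rw [← Matrix.vecMul_vecMul, dilationMatrix, Matrix.vecMul_diagonal]
  by_cases hj : j.val = 0
  · have hj0 : j = 0 := Fin.ext (by simpa using hj)
    have e : (w ᵥ* shearMatrix n s) j = w 0 := by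
      rw [Matrix.vecMul, dotProduct, Fintype.sum_eq_single j]
      · simp [shearMatrix, hj0]
      · intro i hi
        simp [shearMatrix, hi]
        exact fun _ h => absurd hj0 h
    simp [e, freqMap, consVec, hj, mul_comm]
  · have hj0 : (0 : Fin (2 * n)) ≠ j := fun h => hj (by simp [← h])
    have e : (w ᵥ* shearMatrix n s) j = w j + w 0 * s ⟨j.val - 1, by omega⟩ := by
      rw [Matrix.vecMul, dotProduct, Fintype.sum_eq_add j 0 hj0.symm]
      · simp [shearMatrix, hj0, hj0.symm]
      · intro i hi
        simp [shearMatrix, hi.1, hi.2]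
    have hj1 : (⟨j.val - 1 + 1, by omega⟩ : Fin (2 * n)) = j := Fin.ext (by simp; omega)
    simp [e, freqMap, consVec, hj, scaleFactor, hj1]
    ring

theorem freqMap_neg_left [NeZero n] (a : ℝ) (s : Fin (2 * n - 1) → ℝ) (w : Fin (2 * n) → ℝ) :
    freqMap (-a) s w = -freqMap a s w := by
  ext i
  by_cases h : i.val = 0 <;> simp [freqMap, consVec, h, scaleFactor_neg]
  ring

theorem freqMap_neg_right [NeZero n] (a : ℝ) (s : Fin (2 * n - 1) → ℝ) (w : Fin (2 * n) → ℝ) :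
    freqMap a s (-w) = -freqMap a s w := by
  rw [← vecMul_shearMatrix_mul_dilationMatrix, ← vecMul_shearMatrix_mul_dilationMatrix,
    Matrix.neg_vecMul]

/-- The inverse of `S_s A_a`, as it occurs in the definition of the shearlets. -/
noncomputable def atomMatrix (n : ℕ) (a : ℝ) (s : Fin (2 * n - 1) → ℝ) :
    Matrix (Fin (2 * n)) (Fin (2 * n)) ℝ :=
  (dilationMatrix n a)⁻¹ * (shearMatrix n s)⁻¹

theorem abs_det_atomMatrix [NeZero n] (a : ℝ) (s : Fin (2 * n - 1) → ℝ) :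
    |(atomMatrix n a s).det|⁻¹ = dilationJac n a := by
  rw [atomMatrix, Matrix.det_mul, Matrix.det_nonsing_inv, Matrix.det_nonsing_inv, det_shearMatrix,
    Ring.inverse_one, mul_one, Ring.inverse_eq_inv', abs_inv, inv_inv, abs_det_dilationMatrix]

theorem det_atomMatrix_ne_zero [NeZero n] {a : ℝ} (ha : a ≠ 0) (s : Fin (2 * n - 1) → ℝ) :
    (atomMatrix n a s).det ≠ 0 := by
  intro h
  have := abs_det_atomMatrix a s
  rw [h, abs_zero, inv_zero] at this
  exact (dilationJac_pos ha).ne this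

theorem mul_atomMatrix [NeZero n] {a : ℝ} (ha : a ≠ 0) (s : Fin (2 * n - 1) → ℝ) :
    shearMatrix n s * dilationMatrix n a * atomMatrix n a s = 1 := by
  have hA : IsUnit (dilationMatrix n a).det := by
    rw [isUnit_iff_ne_zero, ← abs_pos, abs_det_dilationMatrix]
    exact dilationJac_pos ha
  have hS : IsUnit (shearMatrix n s).det := by rw [det_shearMatrix]; exact isUnit_one
  rw [atomMatrix, ← mul_assoc, mul_assoc (shearMatrix n s), Matrix.mul_nonsing_inv _ hA, mul_one,
    Matrix.mul_nonsing_inv _ hS]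

/-- The untranslated shearlet `ψ_{a,s,0}`. -/
noncomputable def baseAtom (ψ : (Fin (2 * n) → ℝ) → ℍ[ℝ]) (a : ℝ) (s : Fin (2 * n - 1) → ℝ)
    (x : Fin (2 * n) → ℝ) : ℍ[ℝ] :=
  |a| ^ ((1 : ℝ) / (4 * (n : ℝ)) - 1) • ψ (atomMatrix n a s *ᵥ x)

theorem shearletAtom_eq (ψ : (Fin (2 * n) → ℝ) → ℍ[ℝ]) (p : Params n) (x : Fin (2 * n) → ℝ) :
    shearletAtom ψ p x = baseAtom ψ p.1 p.2.1 (x - p.2.2) := rfl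

theorem eLpNorm_shearletAtom [NeZero n] (ψ : (Fin (2 * n) → ℝ) → ℍ[ℝ]) (p : Params n) :
    eLpNorm (shearletAtom ψ p) 2 volume = eLpNorm ψ 2 volume := by
  have ha := p.1.2
  refine (ENNReal.pow_right_strictMono two_ne_zero).injective ?_
  simp only [eLpNorm_two_sq, shearletAtom_eq]
  rw [lintegral_sub_right_eq_self fun x => ‖baseAtom ψ p.1 p.2.1 x‖ₑ ^ 2]
  simp only [baseAtom, enorm_smul, mul_pow]
  rw [lintegral_const_mul' _ _ (by finiteness),
    lintegral_comp_mulVec (det_atomMatrix_ne_zero ha p.2.1) fun x => ‖ψ x‖ₑ ^ 2,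
    abs_det_atomMatrix, ← mul_assoc, enorm_sq_eq_ofReal, ← ENNReal.ofReal_mul (by positivity),
    Real.norm_eq_abs, sq_abs, rpow_sq_mul_dilationJac ha, ENNReal.ofReal_one, one_mul]

theorem isCosSinT_baseAtom [NeZero n] {ψ P S : (Fin (2 * n) → ℝ) → ℍ[ℝ]} (hψ : IsCosSinT ψ P S)
    {a : ℝ} (ha : a ≠ 0) (s : Fin (2 * n - 1) → ℝ) :
    IsCosSinT (baseAtom ψ a s)
      (fun w => (|a| ^ ((1 : ℝ) / (4 * (n : ℝ)) - 1) * dilationJac n a) • P (freqMap a s w))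
      (fun w => (|a| ^ ((1 : ℝ) / (4 * (n : ℝ)) - 1) * dilationJac n a) • S (freqMap a s w)) := by
  have h := (hψ.comp_mulVec (det_atomMatrix_ne_zero ha s) (mul_atomMatrix ha s)).const_mul
    ((|a| ^ ((1 : ℝ) / (4 * (n : ℝ)) - 1) : ℝ) : ℍ[ℝ])
  simp only [Quaternion.coe_mul_eq_smul, smul_smul, abs_det_atomMatrix,
    vecMul_shearMatrix_mul_dilationMatrix] at h
  exact h

/-! ### The change of variables `(a, s) ↦ freqMap a s w` -/

theorem lintegral_comp_add_smul {m : ℕ} {r : ℝ} (hr : r ≠ 0) (b : Fin m → ℝ)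
    (G : (Fin m → ℝ) → ℝ≥0∞) :
    ∫⁻ s, G (b + r • s) = ENNReal.ofReal ((|r| ^ m)⁻¹) * ∫⁻ s, G s := by
  have hdet : (r • (1 : Matrix (Fin m) (Fin m) ℝ)).det = r ^ m := by simp
  have := lintegral_comp_mulVec (N := r • (1 : Matrix (Fin m) (Fin m) ℝ))
    (by rw [hdet]; exact pow_ne_zero _ hr) fun s => G (b + s)
  simp only [Matrix.smul_mulVec, Matrix.one_mulVec, hdet, abs_pow] at this
  rw [this, lintegral_add_left_eq_self]

theorem lintegral_comp_mul_right {r : ℝ} (hr : r ≠ 0) (h : ℝ → ℝ≥0∞) :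
    ENNReal.ofReal |r| * ∫⁻ a, h (a * r) = ∫⁻ x, h x := by
  have hm := Real.smul_map_volume_mul_right hr
  have emb : MeasurableEmbedding fun a : ℝ => a * r :=
    (Homeomorph.mulRight₀ r hr).measurableEmbedding
  conv_rhs => rw [← hm, lintegral_smul_measure, emb.lintegral_map]
  rfl

theorem measurable_consVec (k : ℕ) [NeZero k] :
    Measurable fun p : ℝ × (Fin (k - 1) → ℝ) => (consVec p.1 p.2 : Fin k → ℝ) :=
  (measurePreserving_consVec k).measurable

/-- For `w` off the hyperplane `w 0 = 0`, integrating `Φ` over the orbit of `w` gives a constant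
independent of `w`: the weighted integral of `Φ`. -/
theorem lintegral_orbit [NeZero n] {Φ : (Fin (2 * n) → ℝ) → ℝ≥0∞} (hΦ : Measurable Φ)
    {w : Fin (2 * n) → ℝ} (hw : w 0 ≠ 0) :
    ∫⁻ a : ℝ, ∫⁻ s : Fin (2 * n - 1) → ℝ, ENNReal.ofReal (1 / |a| ^ (2 * n + 1)) *
        (ENNReal.ofReal (dilationJac n a) * Φ (freqMap a s w)) =
      ∫⁻ l, Φ l * (‖l 0‖ₑ ^ (2 * n))⁻¹ := by
  have := neZero_two_mul n
  have hn : 2 * n - 1 + 1 = 2 * n := by have := NeZero.ne n; omega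
  -- the substitution `z = c (w' + w 0 • s)` in `s`, with `c = scaleFactor n a`, leaves a function
  -- of `a * w 0` alone
  set h : ℝ → ℝ≥0∞ := fun x =>
    ENNReal.ofReal (1 / |x| ^ (2 * n)) * ∫⁻ z, Φ (consVec x z) with hh
  have inner : ∀ a : ℝ, a ≠ 0 → ∫⁻ s : Fin (2 * n - 1) → ℝ,
      ENNReal.ofReal (1 / |a| ^ (2 * n + 1)) *
        (ENNReal.ofReal (dilationJac n a) * Φ (freqMap a s w)) =
      ENNReal.ofReal |w 0| * h (a * w 0) := by
    intro a ha
    have hc := scaleFactor_ne_zero (n := n) ha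
    rw [lintegral_const_mul' _ _ ENNReal.ofReal_ne_top,
      lintegral_const_mul' _ _ ENNReal.ofReal_ne_top]
    simp only [freqMap, smul_add, smul_smul]
    rw [lintegral_comp_add_smul (mul_ne_zero hc hw) _ fun z => Φ (consVec (a * w 0) z), hh]
    simp only [← mul_assoc]
    rw [← ENNReal.ofReal_mul (by positivity), ← ENNReal.ofReal_mul
      (mul_nonneg (by positivity) (dilationJac_pos ha).le), ← ENNReal.ofReal_mul (by positivity)]
    congr 2
    have h1 := abs_ne_zero.2 ha
    have h2 := abs_ne_zero.2 hw
    have h3 := abs_ne_zero.2 hc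
    rw [dilationJac, abs_mul, abs_mul, mul_pow, mul_pow]
    have e1 : |w 0| ^ (2 * n) = |w 0| ^ (2 * n - 1) * |w 0| := by rw [← pow_succ, hn]
    rw [e1]
    field_simp
    ring
  have ae0 : ∀ᵐ a : ℝ, a ≠ 0 := by
    simp [ae_iff]
  rw [lintegral_congr_ae (ae0.mono inner), lintegral_const_mul' _ _ ENNReal.ofReal_ne_top,
    lintegral_comp_mul_right hw]
  have mF : Measurable fun l : Fin (2 * n) → ℝ => Φ l * (‖l 0‖ₑ ^ (2 * n))⁻¹ :=
    hΦ.mul ((measurable_pi_apply 0).enorm.pow_const _).inv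
  rw [← (measurePreserving_consVec (2 * n)).lintegral_comp mF]
  refine Eq.trans ?_ (lintegral_prod _ (mF.comp (measurable_consVec _)).aemeasurable).symm
  refine lintegral_congr_ae (ae0.mono fun x hx => ?_)
  have h0 : ∀ z : Fin (2 * n - 1) → ℝ, (consVec x z : Fin (2 * n) → ℝ) 0 = x := fun z => by
    simp [consVec]
  have hfin : (‖x‖ₑ ^ (2 * n))⁻¹ ≠ ∞ := by
    simp [hx]
  simp only [h0, hh, Function.comp_def]
  rw [lintegral_mul_const' _ _ hfin, mul_comm]
  congr 1
  rw [← Real.enorm_abs, Real.enorm_of_nonneg (abs_nonneg x), ← ENNReal.ofReal_pow (abs_nonneg x),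
    ← ENNReal.ofReal_inv_of_pos (by positivity), one_div]

end

/-! ### The Plancherel formula for the shearlet transform -/

section

theorem IsCosSinT.lintegral_enorm_sq {ι : Type*} [Fintype ι] {f P S : (ι → ℝ) → ℍ[ℝ]}
    (hf : IsCosSinT f P S) (hP : StronglyMeasurable P) :
    ∫⁻ w, (‖P w‖ₑ ^ 2 + ‖S w‖ₑ ^ 2) = eLpNorm f 2 volume ^ 2 := by
  have conv : ∀ {a : (ι → ℝ) → ℍ[ℝ]}, MemLp a 2 volume →
      ∫⁻ x, ‖a x‖ₑ ^ 2 = ENNReal.ofReal (∫ x, inner ℝ (a x) (a x)) := by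
    intro a ha
    simp only [real_inner_self_eq_norm_sq]
    rw [ofReal_integral_eq_lintegral_ofReal (ha.integrable_norm_pow two_ne_zero)
      (ae_of_all _ fun x => by positivity)]
    simp only [enorm_sq_eq_ofReal]
  rw [lintegral_add_left (hP.enorm.pow_const 2), eLpNorm_two_sq, conv hf.memLp, conv hf.memLp_cos,
    conv hf.memLp_sin, hf.integral_inner hf, ENNReal.ofReal_add]
  · exact integral_nonneg fun x => real_inner_self_nonneg
  · exact integral_nonneg fun x => real_inner_self_nonneg

theorem measurable_sign : Measurable Real.sign := by
  unfold Real.sign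
  exact Measurable.ite measurableSet_Iio measurable_const
    (Measurable.ite measurableSet_Ioi measurable_const measurable_const)

theorem measurable_scaleFactor (n : ℕ) : Measurable (scaleFactor n) :=
  measurable_sign.mul (measurable_id.abs.pow_const _)

theorem measurable_dilationJac (n : ℕ) : Measurable (dilationJac n) :=
  measurable_id.abs.mul ((measurable_scaleFactor n).abs.pow_const _)

variable {n : ℕ} [NeZero n]

theorem measurable_freqMap : Measurable
    fun y : ℝ × (Fin (2 * n - 1) → ℝ) × (Fin (2 * n) → ℝ) => freqMap y.1 y.2.1 y.2.2 := by
  have := neZero_two_mul n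
  have h0 : Measurable fun y : ℝ × (Fin (2 * n - 1) → ℝ) × (Fin (2 * n) → ℝ) => y.2.2 0 :=
    (measurable_pi_apply 0).comp measurable_snd.snd
  refine (measurable_consVec (2 * n)).comp ((measurable_fst.mul h0).prodMk ?_)
  refine ((measurable_scaleFactor n).comp measurable_fst).smul (Measurable.add ?_ ?_)
  · exact measurable_pi_lambda _ fun j => (measurable_pi_apply _).comp measurable_snd.snd
  · exact h0.smul measurable_snd.fst

/-- The cosine (resp. sine) transform of `ψ_{a,s,0}`, in terms of that of `ψ`. -/
noncomputable def atomFreq (P : (Fin (2 * n) → ℝ) → ℍ[ℝ]) (a : ℝ) (s : Fin (2 * n - 1) → ℝ)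
    (w : Fin (2 * n) → ℝ) : ℍ[ℝ] :=
  (|a| ^ ((1 : ℝ) / (4 * (n : ℝ)) - 1) * dilationJac n a) • P (freqMap a s w)

theorem stronglyMeasurable_atomFreq {P : (Fin (2 * n) → ℝ) → ℍ[ℝ]} (hP : StronglyMeasurable P) :
    StronglyMeasurable fun y : ℝ × (Fin (2 * n - 1) → ℝ) × (Fin (2 * n) → ℝ) =>
      atomFreq P y.1 y.2.1 y.2.2 := by
  have h1 : Measurable fun a : ℝ => |a| ^ ((1 : ℝ) / (4 * (n : ℝ)) - 1) * dilationJac n a :=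
    (measurable_id.abs.pow_const _).mul (measurable_dilationJac n)
  exact (h1.comp measurable_fst).stronglyMeasurable.smul (hP.comp_measurable measurable_freqMap)

theorem atomFreq_neg_left_of_even {P : (Fin (2 * n) → ℝ) → ℍ[ℝ]} (hP : ∀ x, P (-x) = P x) (a : ℝ)
    (s : Fin (2 * n - 1) → ℝ) : atomFreq P (-a) s = atomFreq P a s := by
  ext1 w
  simp only [atomFreq, abs_neg, dilationJac_neg, freqMap_neg_left, hP]

theorem atomFreq_neg_left_of_odd {S : (Fin (2 * n) → ℝ) → ℍ[ℝ]} (hS : ∀ x, S (-x) = -S x) (a : ℝ)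
    (s : Fin (2 * n - 1) → ℝ) : atomFreq S (-a) s = -atomFreq S a s := by
  ext1 w
  simp only [atomFreq, abs_neg, dilationJac_neg, freqMap_neg_left, hS, Pi.neg_apply, smul_neg]

theorem enorm_sq_atomFreq {a : ℝ} (ha : a ≠ 0) (P : (Fin (2 * n) → ℝ) → ℍ[ℝ])
    (s : Fin (2 * n - 1) → ℝ) (w : Fin (2 * n) → ℝ) :
    ‖atomFreq P a s w‖ₑ ^ 2 = ENNReal.ofReal (dilationJac n a) * ‖P (freqMap a s w)‖ₑ ^ 2 := by
  rw [atomFreq, enorm_smul, mul_pow, enorm_sq_eq_ofReal, Real.norm_eq_abs, sq_abs]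
  congr 2
  have := rpow_sq_mul_dilationJac (n := n) ha
  calc _ = ((|a| ^ ((1 : ℝ) / (4 * (n : ℝ)) - 1)) ^ 2 * dilationJac n a) * dilationJac n a := by
        ring
    _ = _ := by rw [this, one_mul]

/-- The squared norm at the frequency `w` of the Fourier transform of
`t ↦ ∫ f(x) conj(ψ_{a,s,t}(x)) dx`, where `f` and `ψ` have the transforms `(Pf, Sf)` and `(P, S)`. -/
noncomputable def spectralDensity (Pf Sf P S : (Fin (2 * n) → ℝ) → ℍ[ℝ]) (a : ℝ)
    (s : Fin (2 * n - 1) → ℝ) (w : Fin (2 * n) → ℝ) : ℝ≥0∞ :=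
  ‖crossRe Pf Sf (atomFreq P a s) (atomFreq S a s) w‖ₑ ^ 2 +
    ‖crossIm Pf Sf (atomFreq P a s) (atomFreq S a s) w‖ₑ ^ 2

section

variable {Pf Sf P S : (Fin (2 * n) → ℝ) → ℍ[ℝ]}

theorem stronglyMeasurable_crossRe_atomFreq (hPf : StronglyMeasurable Pf)
    (hSf : StronglyMeasurable Sf) (hP : StronglyMeasurable P) (hS : StronglyMeasurable S) :
    StronglyMeasurable fun y : ℝ × (Fin (2 * n - 1) → ℝ) × (Fin (2 * n) → ℝ) =>
      crossRe Pf Sf (atomFreq P y.1 y.2.1) (atomFreq S y.1 y.2.1) y.2.2 :=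
  ((hPf.comp_measurable measurable_snd.snd).mul
    (continuous_star.comp_stronglyMeasurable (stronglyMeasurable_atomFreq hP))).add
  ((hSf.comp_measurable measurable_snd.snd).mul
    (continuous_star.comp_stronglyMeasurable (stronglyMeasurable_atomFreq hS)))

theorem stronglyMeasurable_crossIm_atomFreq (hPf : StronglyMeasurable Pf)
    (hSf : StronglyMeasurable Sf) (hP : StronglyMeasurable P) (hS : StronglyMeasurable S) :
    StronglyMeasurable fun y : ℝ × (Fin (2 * n - 1) → ℝ) × (Fin (2 * n) → ℝ) =>
      crossIm Pf Sf (atomFreq P y.1 y.2.1) (atomFreq S y.1 y.2.1) y.2.2 :=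
  ((hSf.comp_measurable measurable_snd.snd).mul
    (continuous_star.comp_stronglyMeasurable (stronglyMeasurable_atomFreq hP))).sub
  ((hPf.comp_measurable measurable_snd.snd).mul
    (continuous_star.comp_stronglyMeasurable (stronglyMeasurable_atomFreq hS)))

theorem measurable_spectralDensity (hPf : StronglyMeasurable Pf)
    (hSf : StronglyMeasurable Sf) (hP : StronglyMeasurable P) (hS : StronglyMeasurable S) :
    Measurable fun y : ℝ × (Fin (2 * n - 1) → ℝ) × (Fin (2 * n) → ℝ) =>
      spectralDensity Pf Sf P S y.1 y.2.1 y.2.2 :=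
  ((stronglyMeasurable_crossRe_atomFreq hPf hSf hP hS).enorm.pow_const 2).add
    ((stronglyMeasurable_crossIm_atomFreq hPf hSf hP hS).enorm.pow_const 2)

theorem spectralDensity_add_neg (hPe : ∀ x, P (-x) = P x) (hSo : ∀ x, S (-x) = -S x)
    {a : ℝ} (ha : a ≠ 0) (s : Fin (2 * n - 1) → ℝ) (w : Fin (2 * n) → ℝ) :
    spectralDensity Pf Sf P S a s w + spectralDensity Pf Sf P S (-a) s w =
      2 * ((‖Pf w‖ₑ ^ 2 + ‖Sf w‖ₑ ^ 2) * (ENNReal.ofReal (dilationJac n a) *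
        (‖P (freqMap a s w)‖ₑ ^ 2 + ‖S (freqMap a s w)‖ₑ ^ 2))) := by
  rw [spectralDensity, spectralDensity, atomFreq_neg_left_of_even hPe,
    atomFreq_neg_left_of_odd hSo, enorm_cross_add_cross_neg, enorm_sq_atomFreq ha,
    enorm_sq_atomFreq ha, mul_add (ENNReal.ofReal _)]

/-- The density `|a|^{-(2n+1)}` of the Haar measure. -/
noncomputable def haarWeight (n : ℕ) (a : ℝ) : ℝ≥0∞ := ENNReal.ofReal (1 / |a| ^ (2 * n + 1))

theorem measurable_haarWeight (n : ℕ) : Measurable (haarWeight n) :=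
  ((measurable_const.div (measurable_id.abs.pow_const _))).ennreal_ofReal

/-- Integration over `a ≠ 0` depends only on the symmetrization of the integrand under `a ↦ -a`.
If that is a product `g(w) F(a,s,w)` and `F` has constant integral `c` in `(a,s)`, then the integral
follows from Tonelli's theorem. -/
theorem lintegral_eq_mul_of_symmetrization {β γ : Type*} [MeasurableSpace β] [MeasurableSpace γ]
    {μ : Measure β} {ν : Measure γ} [SFinite μ] [SFinite ν]
    {G : ℝ → β × γ → ℝ≥0∞} {F : ℝ → β → γ → ℝ≥0∞} {g : γ → ℝ≥0∞} {c : ℝ≥0∞}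
    (mG : Measurable fun y : ℝ × β × γ => G y.1 y.2)
    (mF : Measurable fun y : ℝ × β × γ => F y.1 y.2.1 y.2.2) (mg : Measurable g)
    (hg : ∀ w, g w ≠ ∞)
    (sym : ∀ a ≠ 0, ∀ q, G a q + G (-a) q = 2 * (g q.2 * F a q.1 q.2))
    (orbit : ∀ᵐ w ∂ν, ∫⁻ a, ∫⁻ s, F a s w ∂μ = c) :
    ∫⁻ a, ∫⁻ q, G a q ∂(μ.prod ν) = (∫⁻ w, g w ∂ν) * c := by
  have ae0 : ∀ᵐ a : ℝ, a ≠ 0 := by simp [ae_iff]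
  have mJ : Measurable fun a => ∫⁻ q, G a q ∂(μ.prod ν) := mG.lintegral_prod_right'
  have mI : Measurable fun z : ℝ × γ => ∫⁻ s, F z.1 s z.2 ∂μ := by
    have : Measurable fun z : (ℝ × γ) × β => F z.1.1 z.2 z.1.2 :=
      mF.comp (measurable_fst.fst.prodMk (measurable_snd.prodMk measurable_fst.snd))
    exact this.lintegral_prod_right'
  have sym' : ∀ a : ℝ, a ≠ 0 → ∫⁻ q, G a q ∂(μ.prod ν) + ∫⁻ q, G (-a) q ∂(μ.prod ν) =
      2 * ∫⁻ w, g w * ∫⁻ s, F a s w ∂μ ∂ν := by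
    intro a ha
    have m1 : Measurable fun q => G a q := mG.comp measurable_prodMk_left
    have m2 : Measurable fun q : β × γ => g q.2 * F a q.1 q.2 :=
      (mg.comp measurable_snd).mul (mF.comp measurable_prodMk_left)
    rw [← lintegral_add_left m1, lintegral_congr (sym a ha),
      lintegral_const_mul' _ _ ENNReal.ofNat_ne_top, lintegral_prod_symm' _ m2]
    simp only [lintegral_const_mul' _ _ (hg _)]
  have two : 2 * ∫⁻ a, ∫⁻ q, G a q ∂(μ.prod ν) = 2 * ((∫⁻ w, g w ∂ν) * c) := by
    calc 2 * ∫⁻ a, ∫⁻ q, G a q ∂(μ.prod ν)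
        = (∫⁻ a, ∫⁻ q, G a q ∂(μ.prod ν)) + ∫⁻ a, ∫⁻ q, G (-a) q ∂(μ.prod ν) := by
          rw [lintegral_neg_eq_self (fun a => ∫⁻ q, G a q ∂(μ.prod ν)),
            two_mul (∫⁻ a, ∫⁻ q, G a q ∂(μ.prod ν))]
      _ = ∫⁻ a, 2 * ∫⁻ w, g w * ∫⁻ s, F a s w ∂μ ∂ν := by
          rw [← lintegral_add_left mJ]
          exact lintegral_congr_ae (ae0.mono sym')
      _ = 2 * ∫⁻ w, (∫⁻ a, g w * ∫⁻ s, F a s w ∂μ) ∂ν := by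
          rw [lintegral_const_mul' _ _ ENNReal.ofNat_ne_top,
            lintegral_lintegral_swap ((mg.comp measurable_snd).mul mI).aemeasurable]
      _ = 2 * ((∫⁻ w, g w ∂ν) * c) := by
          simp only [lintegral_const_mul' _ _ (hg _)]
          rw [lintegral_congr_ae (orbit.mono fun w hw => congrArg (g w * ·) hw),
            lintegral_mul_const _ mg]
  exact (ENNReal.mul_right_inj two_ne_zero ENNReal.ofNat_ne_top).1 two

/-- The spectral side of the Plancherel formula: substitution along the orbits, after averaging
over `a ↦ -a`. -/
theorem lintegral_spectralDensity (hPf : StronglyMeasurable Pf)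
    (hSf : StronglyMeasurable Sf) (hP : StronglyMeasurable P) (hS : StronglyMeasurable S)
    (hPe : ∀ x, P (-x) = P x) (hSo : ∀ x, S (-x) = -S x) :
    ∫⁻ a : ℝ, ∫⁻ q : (Fin (2 * n - 1) → ℝ) × (Fin (2 * n) → ℝ),
        haarWeight n a * spectralDensity Pf Sf P S a q.1 q.2 =
      (∫⁻ w, (‖Pf w‖ₑ ^ 2 + ‖Sf w‖ₑ ^ 2)) *
        ∫⁻ l, (‖P l‖ₑ ^ 2 + ‖S l‖ₑ ^ 2) * (‖l 0‖ₑ ^ (2 * n))⁻¹ := by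
  have mΦ : Measurable fun w => ‖P w‖ₑ ^ 2 + ‖S w‖ₑ ^ 2 :=
    (hP.enorm.pow_const 2).add (hS.enorm.pow_const 2)
  refine lintegral_eq_mul_of_symmetrization
    (G := fun a q => haarWeight n a * spectralDensity Pf Sf P S a q.1 q.2)
    (F := fun a s w => haarWeight n a * (ENNReal.ofReal (dilationJac n a) *
      (‖P (freqMap a s w)‖ₑ ^ 2 + ‖S (freqMap a s w)‖ₑ ^ 2)))
    (g := fun w => ‖Pf w‖ₑ ^ 2 + ‖Sf w‖ₑ ^ 2) ?_ ?_ ?_ ?_ ?_ ?_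
  · exact ((measurable_haarWeight n).comp measurable_fst).mul
      (measurable_spectralDensity hPf hSf hP hS)
  · have h1 : Measurable fun a : ℝ => ENNReal.ofReal (dilationJac n a) :=
      (measurable_dilationJac n).ennreal_ofReal
    have h2 := mΦ.comp (measurable_freqMap (n := n))
    exact ((measurable_haarWeight n).comp measurable_fst).mul ((h1.comp measurable_fst).mul h2)
  · exact (hPf.enorm.pow_const 2).add (hSf.enorm.pow_const 2)
  · intro w
    finiteness
  · intro a ha q
    have hw : haarWeight n (-a) = haarWeight n a := by simp only [haarWeight, abs_neg]
    simp only [hw]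
    rw [← mul_add, spectralDensity_add_neg hPe hSo ha]
    ring
  · have aew : ∀ᵐ w : Fin (2 * n) → ℝ, w 0 ≠ 0 :=
      Measure.ae_eval_ne (μ := fun _ => (volume : Measure ℝ)) (0 : Fin (2 * n)) 0
    exact aew.mono fun w hw => lintegral_orbit mΦ hw

end

theorem measurable_shearletDensity (n : ℕ) :
    Measurable fun p : Params n => ENNReal.ofReal (1 / |(p.1 : ℝ)| ^ (2 * n + 1)) :=
  (measurable_haarWeight n).comp (measurable_subtype_coe.comp measurable_fst)

/-- The integral over the shearlet group as an iterated integral, with `a` running through `ℝ`: the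
excluded `a = 0` is a null set. -/
theorem lintegral_shearletMeasure {n : ℕ}
    {G : ℝ × (Fin (2 * n - 1) → ℝ) × (Fin (2 * n) → ℝ) → ℝ≥0∞}
    (hG : Measurable G) :
    ∫⁻ p, G ((p.1 : ℝ), p.2.1, p.2.2) ∂shearletMeasure n =
      ∫⁻ a, ∫⁻ q : (Fin (2 * n - 1) → ℝ) × (Fin (2 * n) → ℝ), haarWeight n a * G (a, q) := by
  have hm : Measurable fun p : Params n => ((p.1 : ℝ), p.2.1, p.2.2) :=
    (measurable_subtype_coe.comp measurable_fst).prodMk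
      (measurable_snd.fst.prodMk measurable_snd.snd)
  have hset : MeasurableSet {a : ℝ | a ≠ 0} := (measurableSet_singleton (0 : ℝ)).compl
  have hres : (volume : Measure ℝ).restrict {a : ℝ | a ≠ 0} = volume :=
    Measure.restrict_eq_self_of_ae_mem (by simp [ae_iff])
  have hmul : Measurable fun p : Params n => haarWeight n p.1 * G ((p.1 : ℝ), p.2.1, p.2.2) :=
    (measurable_shearletDensity n).mul (hG.comp hm)
  rw [shearletMeasure]
  refine (lintegral_withDensity_eq_lintegral_mul _ (measurable_shearletDensity n)
    (hG.comp hm)).trans ?_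
  refine (lintegral_prod _ hmul.aemeasurable).trans ?_
  refine (lintegral_subtype_comap hset fun a => ∫⁻ q : (Fin (2 * n - 1) → ℝ) ×
    (Fin (2 * n) → ℝ), haarWeight n a * G (a, q)).trans ?_
  rw [hres]

section

variable {n : ℕ} [NeZero n] {Pf Sf P S : (Fin (2 * n) → ℝ) → ℍ[ℝ]}

/-- The inverse transform of the pair `(crossRe, crossIm)` built from `f` and `ψ_{a,s,0}`: for
`a ≠ 0` this is the shearlet transform of `f` at `(a, s, t)`, in a form in which joint measurability
in `(a, s, t)` is visible. -/
noncomputable def spectralTransform (Pf Sf P S : (Fin (2 * n) → ℝ) → ℍ[ℝ])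
    (y : ℝ × (Fin (2 * n - 1) → ℝ) × (Fin (2 * n) → ℝ)) : ℍ[ℝ] :=
  cosT (crossRe Pf Sf (atomFreq P y.1 y.2.1) (atomFreq S y.1 y.2.1)) y.2.2 +
    sinT (crossIm Pf Sf (atomFreq P y.1 y.2.1) (atomFreq S y.1 y.2.1)) y.2.2

theorem stronglyMeasurable_spectralTransform (hPf : StronglyMeasurable Pf)
    (hSf : StronglyMeasurable Sf) (hP : StronglyMeasurable P) (hS : StronglyMeasurable S) :
    StronglyMeasurable (spectralTransform Pf Sf P S) := by
  have m : Measurable fun z : (ℝ × (Fin (2 * n - 1) → ℝ) × (Fin (2 * n) → ℝ)) ×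
      (Fin (2 * n) → ℝ) => (z.1.1, z.1.2.1, z.2) :=
    measurable_fst.fst.prodMk (measurable_fst.snd.fst.prodMk measurable_snd)
  have d : Continuous fun z : (ℝ × (Fin (2 * n - 1) → ℝ) × (Fin (2 * n) → ℝ)) ×
      (Fin (2 * n) → ℝ) => 2 * Real.pi * (z.1.2.2 ⬝ᵥ z.2) :=
    continuous_const.mul (Continuous.dotProduct (by fun_prop) (by fun_prop))
  have hc := (Real.continuous_cos.comp d).stronglyMeasurable.smul
    ((stronglyMeasurable_crossRe_atomFreq hPf hSf hP hS).comp_measurable m)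
  have hs := (Real.continuous_sin.comp d).stronglyMeasurable.smul
    ((stronglyMeasurable_crossIm_atomFreq hPf hSf hP hS).comp_measurable m)
  exact hc.integral_prod_right'.add hs.integral_prod_right'

variable {ψ f : (Fin (2 * n) → ℝ) → ℍ[ℝ]}

theorem shearletTransform_eq_spectralTransform (hf : IsCosSinT f Pf Sf) (hψ : IsCosSinT ψ P S)
    (p : Params n) :
    shearletTransform ψ f p = spectralTransform Pf Sf P S ((p.1 : ℝ), p.2.1, p.2.2) :=
  hf.correlation_eq (isCosSinT_baseAtom hψ p.1.2 p.2.1) p.2.2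

/-- Plancherel's theorem in the translation variable, for fixed `a` and `s`. -/
theorem lintegral_enorm_sq_spectralTransform (hf : IsCosSinT f Pf Sf) (hψ : IsCosSinT ψ P S)
    (hPf : ∀ x, Pf (-x) = Pf x) (hSf : ∀ x, Sf (-x) = -Sf x)
    (hP : ∀ x, P (-x) = P x) (hS : ∀ x, S (-x) = -S x) {a : ℝ} (ha : a ≠ 0)
    (s : Fin (2 * n - 1) → ℝ) (hfin : ∫⁻ w, spectralDensity Pf Sf P S a s w ≠ ∞) :
    ∫⁻ t, ‖spectralTransform Pf Sf P S (a, s, t)‖ₑ ^ 2 =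
      ∫⁻ w, spectralDensity Pf Sf P S a s w := by
  have hb := isCosSinT_baseAtom hψ ha s
  refine Eq.trans (lintegral_congr fun t => ?_) (hf.lintegral_correlation hb hPf hSf ?_ ?_ hfin)
  · exact congrArg (‖·‖ₑ ^ 2) (hf.correlation_eq hb t).symm
  · intro x
    simp only [atomFreq, freqMap_neg_right, hP]
  · intro x
    simp only [atomFreq, freqMap_neg_right, hS, smul_neg]

/-- If the fibre integrals of `V` and `D` agree wherever the latter is finite, and `D` has a finite
weighted integral, then `V` and `D` have the same weighted integral. -/
theorem lintegral_eq_of_fiberwise {α β γ : Type*} [MeasurableSpace α] [MeasurableSpace β]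
    [MeasurableSpace γ] {κ : Measure α} {μ : Measure β} {ν : Measure γ} [SFinite μ] [SFinite ν]
    {h : α → ℝ≥0∞} {V D : α × β × γ → ℝ≥0∞} (mh : Measurable h) (mV : Measurable V)
    (mD : Measurable D) (h0 : ∀ᵐ a ∂κ, h a ≠ 0)
    (hfin : ∫⁻ a, ∫⁻ q, h a * D (a, q) ∂(μ.prod ν) ∂κ ≠ ∞)
    (fib : ∀ᵐ a ∂κ, ∀ s, ∫⁻ w, D (a, s, w) ∂ν ≠ ∞ →
      ∫⁻ t, V (a, s, t) ∂ν = ∫⁻ w, D (a, s, w) ∂ν) :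
    ∫⁻ a, ∫⁻ q, h a * V (a, q) ∂(μ.prod ν) ∂κ = ∫⁻ a, ∫⁻ q, h a * D (a, q) ∂(μ.prod ν) ∂κ := by
  have mJ : Measurable fun a => ∫⁻ q, h a * D (a, q) ∂(μ.prod ν) :=
    ((mh.comp measurable_fst).mul mD).lintegral_prod_right'
  refine lintegral_congr_ae ?_
  filter_upwards [h0, fib, ae_lt_top mJ hfin] with a ha hfib hfa
  have m1 : Measurable fun q : β × γ => V (a, q) := mV.comp measurable_prodMk_left
  have m2 : Measurable fun q : β × γ => D (a, q) := mD.comp measurable_prodMk_left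
  rw [lintegral_const_mul _ m2, lintegral_prod _ m2.aemeasurable] at hfa
  rw [lintegral_const_mul _ m1, lintegral_const_mul _ m2, lintegral_prod _ m1.aemeasurable,
    lintegral_prod _ m2.aemeasurable]
  congr 1
  have hD : ∫⁻ s, ∫⁻ w, D (a, s, w) ∂ν ∂μ ≠ ∞ := by
    intro h
    rw [h, ENNReal.mul_top ha] at hfa
    exact lt_irrefl _ hfa
  exact lintegral_congr_ae
    ((ae_lt_top m2.lintegral_prod_right' hD).mono fun s hs => hfib s hs.ne)

/-- The Plancherel formula: the shearlet transform multiplies the `L²` norm by `√C_ψ`. -/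
theorem lintegral_enorm_sq_shearletTransform (hψ : IsAdmissible ψ) (hf : MemLp f 2 volume) :
    ∫⁻ p, ‖shearletTransform ψ f p‖ₑ ^ 2 ∂shearletMeasure n =
      eLpNorm f 2 volume ^ 2 * admissibilityConst ψ := by
  obtain ⟨Pf, Sf, mPf, mSf, ePf, oSf, tf⟩ := exists_isCosSinT hf
  obtain ⟨P, S, mP, mS, eP, oS, tψ⟩ := exists_isCosSinT hψ.1
  have mV : Measurable fun y => ‖spectralTransform Pf Sf P S y‖ₑ ^ 2 :=
    (stronglyMeasurable_spectralTransform mPf mSf mP mS).enorm.pow_const 2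
  have total := lintegral_spectralDensity mPf mSf mP mS eP oS
  rw [tf.lintegral_enorm_sq mPf, ← admissibilityConst_eq tψ mP mS eP oS] at total
  have ne_top : eLpNorm f 2 volume ^ 2 * admissibilityConst ψ ≠ ∞ :=
    ENNReal.mul_ne_top (ENNReal.pow_ne_top hf.eLpNorm_ne_top) hψ.2.ne
  have ae0 : ∀ᵐ a : ℝ, a ≠ 0 := by simp [ae_iff]
  have pos : ∀ a : ℝ, a ≠ 0 → haarWeight n a ≠ 0 := by
    intro a ha
    have := abs_pos.2 ha
    rw [haarWeight, ne_eq, ENNReal.ofReal_eq_zero, not_le]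
    positivity
  simp only [shearletTransform_eq_spectralTransform tf tψ]
  rw [lintegral_shearletMeasure mV, ← total]
  exact lintegral_eq_of_fiberwise (measurable_haarWeight n) mV
    (measurable_spectralDensity mPf mSf mP mS) (ae0.mono pos) (total ▸ ne_top) (ae0.mono fun a ha s hs =>
      lintegral_enorm_sq_spectralTransform tf tψ ePf oSf eP oS ha s hs)

/-- The Cauchy–Schwarz bound: each `ψ_{a,s,t}` has the same `L²` norm as `ψ`. -/
theorem enorm_shearletTransform_le (hψ : MemLp ψ 2 volume) (hf : MemLp f 2 volume)
    (p : Params n) :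
    ‖shearletTransform ψ f p‖ₑ ≤ eLpNorm f 2 volume * eLpNorm ψ 2 volume := by
  obtain ⟨P, S, -, -, -, -, tψ⟩ := exists_isCosSinT hψ
  have hm : MemLp (shearletAtom ψ p) 2 volume :=
    ((isCosSinT_baseAtom tψ p.1.2 p.2.1).translate p.2.2).memLp
  calc ‖shearletTransform ψ f p‖ₑ ≤ eLpNorm (fun x => f x * star (shearletAtom ψ p x)) 1 volume := by
        rw [eLpNorm_one_eq_lintegral_enorm]
        exact enorm_integral_le_lintegral_enorm _
    _ ≤ (1 : NNReal) * eLpNorm f 2 volume * eLpNorm (shearletAtom ψ p) 2 volume :=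
        eLpNorm_le_eLpNorm_mul_eLpNorm'_of_norm hf.1 hm.1 (fun a b => a * star b) 1
          (ae_of_all _ fun x => by rw [norm_mul, norm_star, NNReal.coe_one, one_mul])
    _ = eLpNorm f 2 volume * eLpNorm ψ 2 volume := by
        rw [eLpNorm_shearletAtom, ENNReal.coe_one, one_mul]

end

end

end QShearlet

/-! ### Concentration -/

theorem mainTheorem5 (n : ℕ) [NeZero n]
    (ψ f : (Fin (2 * n) → ℝ) → ℍ[ℝ])
    (hψ : QShearlet.IsAdmissible ψ) (hψ0 : ¬ ψ =ᵐ[volume] 0)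
    (hf : MemLp f 2 volume) (hf0 : ¬ f =ᵐ[volume] 0)
    (E : Set (QShearlet.Params n)) (hE : NullMeasurableSet E (QShearlet.shearletMeasure n))
    (ξ : ℝ) (hξ : 0 ≤ ξ)
    (hconc : QShearlet.IsConcentrated ξ E (QShearlet.shearletTransform ψ f)) :
    ENNReal.ofReal (1 - ξ ^ 2) * QShearlet.admissibilityConst ψ / eLpNorm ψ 2 volume ^ 2 ≤
      QShearlet.shearletMeasure n E := by
  have total := QShearlet.lintegral_enorm_sq_shearletTransform hψ hf
  set μ := QShearlet.shearletMeasure n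
  set C := QShearlet.admissibilityConst ψ
  set F := QShearlet.shearletTransform ψ f
  set A := eLpNorm f 2 volume ^ 2 with hA
  set B := eLpNorm ψ 2 volume ^ 2 with hB
  have A0 : A ≠ 0 := pow_ne_zero 2 fun h => hf0 ((eLpNorm_eq_zero_iff hf.1 two_ne_zero).1 h)
  have A1 : A ≠ ∞ := ENNReal.pow_ne_top hf.eLpNorm_ne_top
  have C1 : C ≠ ∞ := hψ.2.ne
  -- the part of the norm on `E`, by the pointwise bound
  have inside : ∫⁻ p in E, ‖F p‖ₑ ^ 2 ∂μ ≤ A * (B * μ E) := by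
    calc ∫⁻ p in E, ‖F p‖ₑ ^ 2 ∂μ ≤ ∫⁻ _ in E, A * B ∂μ := by
          refine lintegral_mono fun p => ?_
          rw [hA, hB, ← mul_pow]
          exact pow_le_pow_left' (QShearlet.enorm_shearletTransform_le hψ.1 hf p) 2
      _ = A * (B * μ E) := by rw [setLIntegral_const, mul_assoc]
  -- the part of the norm off `E`, by concentration
  have outside : ∫⁻ p in Eᶜ, ‖F p‖ₑ ^ 2 ∂μ ≤ ENNReal.ofReal (ξ ^ 2) * (A * C) := by
    have := pow_le_pow_left' hconc 2
    rwa [mul_pow, QShearlet.eLpNorm_two_sq, QShearlet.eLpNorm_two_sq, total,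
      ← ENNReal.ofReal_pow hξ] at this
  have split : A * C ≤ A * (B * μ E) + ENNReal.ofReal (ξ ^ 2) * (A * C) := by
    calc A * C = ∫⁻ p in E ∪ Eᶜ, ‖F p‖ₑ ^ 2 ∂μ := by
          rw [Set.union_compl_self, setLIntegral_univ, total]
      _ ≤ _ := (lintegral_union_le _ _ _).trans (add_le_add inside outside)
  refine ENNReal.div_le_of_le_mul' ?_
  refine (ENNReal.mul_le_mul_iff_right A0 A1).1 ?_
  calc A * (ENNReal.ofReal (1 - ξ ^ 2) * C)
      = A * C - ENNReal.ofReal (ξ ^ 2) * (A * C) := by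
        -- for `ξ > 1` both sides are `0`, as `ENNReal.ofReal` and the subtraction truncate
        rw [ENNReal.ofReal_sub _ (sq_nonneg ξ), ENNReal.ofReal_one, mul_left_comm,
          ENNReal.sub_mul fun _ _ => ENNReal.mul_ne_top A1 C1, one_mul]
    _ ≤ A * (B * μ E) := tsub_le_iff_right.2 split
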